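/- Let $R$ be a rational map with complex coefficients, viewed as a self-map of the Riemann sphere $\hat{\mathbb C}=\mathbb C\cup\{\infty\}$. The Fatou set $\mathcal F(R)$ is the set of points of $\hat{\mathbb C}$ that have a neighbourhood on which the family of iterates $\{R^n\}_{n\ge 0}$ is normal (every sequence in the family has a subsequence converging locally uniformly in the spherical metric), and the Julia set is $\mathcal J(R)=\hat{\mathbb C}\setminus\mathcal F(R)$. A Fatou component is a connected component of $\mathcal F(R)$; it is called unbounded if its intersection with $\mathbb C$ is an unbounded subset of $\mathbb C$. Let $\ell\ge 2$ and let $U_1,\dots,U_\ell$ be pairwise distinct unbounded Fatou components of $R$. Assume that for every pole $p\in\mathbb C$ of $R$ there are $i,j\in\{1,\dots,\ell\}$ with $i\ne j$ and $p\in\partial U_i\cap\partial U_j$. Then the Julia set $\mathcal J(R)$ is a (non-empty) connected subset of $\hat{\mathbb C}$. -/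

import Mathlib

open Filter Topology OnePoint

noncomputable section

/-- The Riemann sphere `ℂ ∪ {∞}`, with the topology of the one-point compactification. -/
abbrev RiemannSphere : Type := OnePoint ℂ

namespace RiemannSphere

/-- The sphere is compact and Hausdorff, so exactly one uniform structure induces its topology:
it is the uniform structure of the chordal (equivalently, the spherical) metric. -/
instance instUniformSpace : UniformSpace RiemannSphere := uniformSpaceOfCompactR1

/-- A family of self-maps of the sphere is normal on `U` if every sequence in the family has a
subsequence that converges locally uniformly on `U` (with respect to the spherical metric). -/
def IsNormalOn (ℱ : Set (RiemannSphere → RiemannSphere)) (U : Set RiemannSphere) : Prop :=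
  ∀ f : ℕ → RiemannSphere → RiemannSphere, (∀ n, f n ∈ ℱ) →
    ∃ (g : RiemannSphere → RiemannSphere) (φ : ℕ → ℕ), StrictMono φ ∧
      TendstoLocallyUniformlyOn (fun n => f (φ n)) g atTop U

/-- A subset of the sphere is unbounded if its finite part is unbounded in `ℂ`. -/
def IsUnbounded (U : Set RiemannSphere) : Prop :=
  ¬ Bornology.IsBounded {z : ℂ | (z : RiemannSphere) ∈ U}

end RiemannSphere

open Classical in
/-- The self-map of the Riemann sphere given by a rational function `P / Q` in lowest terms:
`z ↦ P(z) / Q(z)` for finite `z` with `Q(z) ≠ 0`, `z ↦ ∞` for finite `z` with `Q(z) = 0`, and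
`∞ ↦ lim_{z → ∞} P(z) / Q(z)`, which is `∞` if `deg P > deg Q`, and otherwise the
coefficient of `P` in degree `deg Q` divided by the leading coefficient of `Q`. -/
def rationalMap (R : RatFunc ℂ) : RiemannSphere → RiemannSphere
  | ∞ => if R.denom.natDegree < R.num.natDegree then ∞
      else ((R.num.coeff R.denom.natDegree / R.denom.leadingCoeff : ℂ) : RiemannSphere)
  | (z : ℂ) => if R.denom.eval z = 0 then ∞
      else ((R.num.eval z / R.denom.eval z : ℂ) : RiemannSphere)

/-- A (finite) pole of `R`: a point of `ℂ` that `R` maps to `∞`. -/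
def IsPole (R : RatFunc ℂ) (p : ℂ) : Prop :=
  rationalMap R (p : RiemannSphere) = ∞

/-- The Fatou set: the points with an open neighbourhood on which the iterates are normal. -/
def fatouSet (R : RatFunc ℂ) : Set RiemannSphere :=
  {z | ∃ U : Set RiemannSphere, IsOpen U ∧ z ∈ U ∧
    RiemannSphere.IsNormalOn (Set.range fun n : ℕ => (rationalMap R)^[n]) U}

/-- The Julia set: the complement of the Fatou set in the sphere. -/
def juliaSet (R : RatFunc ℂ) : Set RiemannSphere := (fatouSet R)ᶜ

/-- A Fatou component: a connected component of the Fatou set. -/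
def IsFatouComponent (R : RatFunc ℂ) (U : Set RiemannSphere) : Prop :=
  ∃ z ∈ fatouSet R, U = connectedComponentIn (fatouSet R) z

end

/-! Two distinct unbounded components keep `∞` in the Julia set: otherwise the component of `∞`
would meet, hence equal, both. They also force a finite pole `p`, since a map without poles is a
polynomial, and then either `∞` is a Fatou point or the whole plane is Fatou (`exists_pole`).

Suppose the Julia set splits into two disjoint closed parts, and let `b` be a point of the part
without `∞`. Plane topology (`exists_isOpen_frontier_subset_component`) gives a bounded open `G`
containing `b` whose boundary lies in a single plane domain `D` of the Fatou set.

No iterate takes the value `∞` on `G` (`iterate_ne_infty`). At a first failure some `f = R^n` sends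
a point of `G` to a pole, which lies in the closures of two unbounded components. Each of these
meets the open set `f(G)` and also leaves its closure, because `f(G)` stays away from `∞`. Being
connected, each meets the boundary of `f(G)`, which lies in the connected Fatou subset `f(D)`. So
both contain `f(D)` and coincide, a contradiction.

Hence the iterates omit both `∞` and `p` on `G`. On the boundary of `G` a subsequence converges, by
Hurwitz either to `∞` everywhere or to finite values everywhere; the maximum principle, for `1 / (f
- p)` or for differences of iterates, carries the convergence into `G`
(`isNormalOn_of_frontier_subset`). So `b` is a Fatou point, a contradiction. -/

/-! ### Plane separation by continuous logarithms -/

/-- A locally constant property propagates along a preconnected set. -/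
theorem IsPreconnected.of_eventually_iff {X : Type*} [TopologicalSpace X] {S : Set X}
    (hS : IsPreconnected S) {P : X → Prop} (h : ∀ x ∈ S, ∀ᶠ y in 𝓝 x, (P x ↔ P y)) {x y : X}
    (hx : x ∈ S) (hy : y ∈ S) (hPx : P x) : P y := by
  by_contra hPy
  obtain ⟨z, hz, hz1, hz2⟩ := hS (interior {d | P d}) (interior {d | ¬ P d})
    isOpen_interior isOpen_interior (fun d hd => by
      by_cases hd' : P d
      · left
        rw [mem_interior_iff_mem_nhds]
        filter_upwards [h d hd] with e he using he.1 hd'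
      · right
        rw [mem_interior_iff_mem_nhds]
        filter_upwards [h d hd] with e he using fun h => hd' (he.2 h))
    ⟨x, hx, by
      rw [mem_interior_iff_mem_nhds]
      filter_upwards [h x hx] with e he using he.1 hPx⟩
    ⟨y, hy, by
      rw [mem_interior_iff_mem_nhds]
      filter_upwards [h y hy] with e he using fun h => hPy (he.2 h)⟩
  exact (interior_subset hz2 : z ∈ {d | ¬ P d}) (interior_subset hz1 : z ∈ {d | P d})

/-- `z ↦ z - b` has a continuous logarithm on `K`. -/
def HasLogOn (K : Set ℂ) (b : ℂ) : Prop :=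
  ∃ h : ℂ → ℂ, ContinuousOn h K ∧ ∀ z ∈ K, Complex.exp (h z) = z - b

/-- A map of the plane agreeing with `z - b` off a bounded set must vanish somewhere. -/
theorem exists_zero_of_eq_sub_of_bounded {f : ℂ → ℂ} (hf : Continuous f) {b : ℂ} {r : ℝ}
    (hr : 0 < r) (hfb : ∀ z, ‖z - b‖ = r → f z = z - b) : ∃ z, f z = 0 := by
  by_contra! h0
  obtain ⟨g, hg, hge⟩ := Complex.exists_continuousOn_eqOn_exp_comp (X := ℂ) (U := Set.univ)
    (by
      have := (convex_univ (𝕜 := ℝ) (E := ℂ)).contractibleSpace Set.univ_nonempty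
      exact inferInstanceAs (SimplyConnectedSpace (Set.univ : Set ℂ)))
    isOpen_univ hf.continuousOn (by simpa using h0)
  rw [continuousOn_univ] at hg
  -- Along the circle, `k` is a continuous logarithm of the constant `r`, so its imaginary part can
  -- only jump by multiples of `2π`; yet it drops by `2π` in one turn and must pass the midpoint
  -- value.
  let k : ℝ → ℂ := fun t => g (b + r * Complex.exp (t * Complex.I)) - t * Complex.I
  have hk : Continuous k := by fun_prop
  have hek : ∀ t, Complex.exp (k t) = r := by
    intro t
    have h1 : Complex.exp (g (b + r * Complex.exp (t * Complex.I))) =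
        r * Complex.exp (t * Complex.I) := by
      have := hge (Set.mem_univ (b + r * Complex.exp (t * Complex.I)))
      simp only [Function.comp] at this
      rw [this, hfb]
      · ring
      · simp [Complex.norm_exp_ofReal_mul_I, abs_of_pos hr]
    simp only [k, Complex.exp_sub, h1]
    field_simp [Complex.exp_ne_zero]
  have hper : k (2 * Real.pi) = k 0 - 2 * Real.pi * Complex.I := by
    simp [k, Complex.exp_two_pi_mul_I]
  have him : (k (2 * Real.pi)).im = (k 0).im - 2 * Real.pi := by
    rw [hper]; simp
  obtain ⟨t, -, ht⟩ := intermediate_value_Icc' (by positivity : (0 : ℝ) ≤ 2 * Real.pi)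
    (f := fun t => (k t).im) (by fun_prop)
    (show (k 0).im - Real.pi ∈ Set.Icc _ _ by
      constructor
      · rw [him]; linarith [Real.pi_pos]
      · linarith [Real.pi_pos])
  obtain ⟨n, hn⟩ := Complex.exp_eq_exp_iff_exists_int.1 ((hek t).trans (hek 0).symm)
  have h2 := congrArg Complex.im hn
  simp only at ht
  rw [ht] at h2
  simp at h2
  have h3 : Real.pi * (1 + 2 * (n : ℝ)) = 0 := by linarith
  rcases mul_eq_zero.1 h3 with h4 | h4
  · exact Real.pi_ne_zero h4
  · have h5 : (1 + 2 * n : ℤ) = 0 := by exact_mod_cast h4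
    omega

/-- The boundary of a component of an open set is disjoint from the open set. -/
theorem notMem_of_mem_frontier_connectedComponentIn {X : Type*} [TopologicalSpace X]
    [LocallyConnectedSpace X] {F : Set X} (hF : IsOpen F) {x z : X}
    (hz : z ∈ frontier (connectedComponentIn F x)) : z ∉ F := by
  intro hzF
  obtain ⟨y, hy1, hy2⟩ := mem_closure_iff.1 (frontier_subset_closure hz) _
    hF.connectedComponentIn (mem_connectedComponentIn hzF)
  refine hz.2 ?_
  rw [hF.connectedComponentIn.interior_eq, connectedComponentIn_eq hy2, ← connectedComponentIn_eq hy1]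
  exact mem_connectedComponentIn hzF

/-- By Tietze a logarithm on the boundary extends to a continuous `g` on the plane. Then `exp g` on
`W`, glued to `z - b` outside, is zero-free although it equals `z - b` on a large circle. -/
theorem not_hasLogOn_frontier {W : Set ℂ} (hWb : Bornology.IsBounded W) {b : ℂ}
    (hb : b ∈ W) : ¬ HasLogOn (frontier W) b := by
  classical
  rintro ⟨h, hc, he⟩
  obtain ⟨g, hg⟩ := ContinuousMap.exists_restrict_eq (isClosed_frontier (s := W))
    ⟨(frontier W).domRestrict h, continuousOn_iff_continuous_domRestrict.1 hc⟩
  have hgh : ∀ z ∈ frontier W, g z = h z := fun z hz => congr($hg ⟨z, hz⟩)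
  obtain ⟨r, hr⟩ := hWb.subset_ball b
  have hr0 : 0 < r := by simpa using (hr hb)
  have hcont : Continuous (W.piecewise (fun z => Complex.exp (g z)) (fun z => z - b)) := by
    refine Continuous.piecewise (fun z hz => ?_) (by fun_prop) (by fun_prop)
    simp only [hgh z hz, he z hz]
  obtain ⟨z, hz⟩ := exists_zero_of_eq_sub_of_bounded hcont (b := b) hr0 (fun z hz => by
    refine Set.piecewise_eq_of_notMem _ _ _ fun hzW => ?_
    have := hr hzW
    rw [mem_ball_iff_norm] at this
    linarith)
  by_cases hzW : z ∈ W
  · rw [Set.piecewise_eq_of_mem _ _ _ hzW] at hz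
    exact Complex.exp_ne_zero _ hz
  · rw [Set.piecewise_eq_of_notMem _ _ _ hzW, sub_eq_zero] at hz
    exact hzW (hz ▸ hb)

/-- Factor `z - d = (z - c) (1 - (d - c) / (z - c))`; the second factor lies within distance `1` of
`1`, where the principal logarithm is continuous. -/
theorem HasLogOn.of_near {K : Set ℂ} {c d : ℂ} (h : HasLogOn K c)
    (hcd : ∀ z ∈ K, ‖d - c‖ < ‖z - c‖) : HasLogOn K d := by
  obtain ⟨g, hg, he⟩ := h
  have hne : ∀ z ∈ K, z - c ≠ 0 := fun z hz h0 => by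
    have := hcd z hz
    rw [h0, norm_zero] at this
    exact absurd this (not_lt.2 (norm_nonneg _))
  have hs : ∀ z ∈ K, 1 - (d - c) / (z - c) ∈ Complex.slitPlane := fun z hz => by
    rw [sub_eq_add_neg]
    apply Complex.mem_slitPlane_of_norm_lt_one
    rw [norm_neg, norm_div, div_lt_one (norm_pos_iff.2 (hne z hz))]
    exact hcd z hz
  refine ⟨fun z => g z + Complex.log (1 - (d - c) / (z - c)), ?_, fun z hz => ?_⟩
  · refine hg.add (ContinuousOn.clog ?_ hs)
    exact continuousOn_const.sub (continuousOn_const.div (by fun_prop) hne)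
  · rw [Complex.exp_add, he z hz, Complex.exp_log (Complex.slitPlane_ne_zero (hs z hz))]
    field_simp [hne z hz]
    ring

theorem HasLogOn.of_far {K : Set ℂ} {c : ℂ} (hc : ∀ z ∈ K, ‖z‖ < ‖c‖) : HasLogOn K c := by
  have hs : ∀ z ∈ K, 1 - z / c ∈ Complex.slitPlane ∧ c ≠ 0 := fun z hz => by
    have h0 : 0 < ‖c‖ := (norm_nonneg z).trans_lt (hc z hz)
    refine ⟨?_, norm_pos_iff.1 h0⟩
    rw [sub_eq_add_neg]
    apply Complex.mem_slitPlane_of_norm_lt_one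
    rw [norm_neg, norm_div, div_lt_one h0]
    exact hc z hz
  refine ⟨fun z => Complex.log (-c) + Complex.log (1 - z / c), ?_, fun z hz => ?_⟩
  · exact continuousOn_const.add (ContinuousOn.clog (by fun_prop) fun z hz => (hs z hz).1)
  · have := (hs z hz).2
    rw [Complex.exp_add, Complex.exp_log (neg_ne_zero.2 this),
      Complex.exp_log (Complex.slitPlane_ne_zero (hs z hz).1)]
    field_simp
    ring

/-- Existence of a logarithm is locally constant in the base point off `K`, and holds for base
points of large modulus; an unbounded component of the complement contains such points. -/
theorem hasLogOn_of_not_isBounded {K : Set ℂ} (hK : IsCompact K) {b : ℂ} (hb : b ∉ K)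
    (hub : ¬ Bornology.IsBounded (connectedComponentIn Kᶜ b)) : HasLogOn K b := by
  rcases K.eq_empty_or_nonempty with rfl | hne
  · exact ⟨0, by simp, by simp⟩
  have hnear : ∀ c ∉ K, ∀ᶠ d in 𝓝 c, (HasLogOn K c ↔ HasLogOn K d) := fun c hc => by
    have hpos : 0 < Metric.infDist c K :=
      (hK.isClosed.notMem_iff_infDist_pos hne).1 hc
    -- Half the distance to `K` makes `of_near` applicable both from `c` to `d` and from `d` to `c`.
    filter_upwards [Metric.ball_mem_nhds c (half_pos hpos)] with d hd
    rw [mem_ball_iff_norm] at hd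
    have hz : ∀ z ∈ K, Metric.infDist c K ≤ ‖z - c‖ := fun z hz => by
      rw [← dist_eq_norm, dist_comm]
      exact Metric.infDist_le_dist_of_mem hz
    constructor
    · exact fun h => h.of_near fun z hzK => by linarith [hz z hzK]
    · refine fun h => h.of_near fun z hzK => ?_
      have h1 : ‖z - c‖ ≤ ‖z - d‖ + ‖d - c‖ := by
        simpa using norm_add_le (z - d) (d - c)
      rw [norm_sub_rev c d]
      linarith [hz z hzK]
  have hpre := isPreconnected_connectedComponentIn (F := Kᶜ) (x := b)
  have hsub := connectedComponentIn_subset Kᶜ b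
  obtain ⟨M, hM⟩ := hK.isBounded.exists_norm_le
  obtain ⟨c, hcG, hcM⟩ : ∃ c ∈ connectedComponentIn Kᶜ b, M < ‖c‖ := by
    by_contra! h
    exact hub ((Metric.isBounded_closedBall (x := (0 : ℂ)) (r := M)).subset
      fun z hz => by simpa using h z hz)
  have hclog : HasLogOn K c := HasLogOn.of_far fun z hz => (hM z hz).trans_lt hcM
  exact hpre.of_eventually_iff (fun d hd => hnear d (hsub hd)) hcG (mem_connectedComponentIn hb) hclog

/-- If the boundary of a bounded plane open set `W` lies in an open set `F` not containing the point
`b` of `W`, then `b` lies in a bounded open set whose boundary lies in a single component of `F`. -/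
theorem exists_isOpen_frontier_subset_component {F W : Set ℂ} (hF : IsOpen F)
    (hWb : Bornology.IsBounded W) (hWF : frontier W ⊆ F) {b : ℂ} (hbW : b ∈ W) (hbF : b ∉ F) :
    ∃ x ∈ F, ∃ G : Set ℂ, IsOpen G ∧ Bornology.IsBounded G ∧ b ∈ G ∧
      frontier G ⊆ connectedComponentIn F x := by
  have hK : IsCompact (frontier W) :=
    hWb.isCompact_closure.of_isClosed_subset isClosed_frontier frontier_subset_closure
  obtain ⟨x, hx, hlog⟩ : ∃ x ∈ frontier W,
      ¬ HasLogOn (frontier W ∩ connectedComponentIn F x) b := by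
    by_contra! h
    -- Logarithms are chosen per set, not per point, so that points of one component share the same
    -- branch and the branches glue.
    have h' : ∀ S : Set ℂ, ∃ g : ℂ → ℂ, HasLogOn (frontier W ∩ S) b →
        ContinuousOn g (frontier W ∩ S) ∧ ∀ z ∈ frontier W ∩ S, Complex.exp (g z) = z - b := by
      intro S
      by_cases hS : HasLogOn (frontier W ∩ S) b
      · obtain ⟨g, hg⟩ := hS
        exact ⟨g, fun _ => hg⟩
      · exact ⟨0, fun h => absurd h hS⟩
    choose g hg using h'
    refine not_hasLogOn_frontier hWb hbW ⟨fun z => g (connectedComponentIn F z) z, ?_, ?_⟩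
    · intro z hz
      have hzc := mem_connectedComponentIn (hWF hz)
      have hnhds : connectedComponentIn F z ∈ 𝓝 z := hF.connectedComponentIn.mem_nhds hzc
      have h1 := ((hg _ (h z hz)).1 z ⟨hz, hzc⟩).mono_of_mem_nhdsWithin
        (inter_mem self_mem_nhdsWithin (mem_nhdsWithin_of_mem_nhds hnhds))
      refine h1.congr_of_eventuallyEq ?_ rfl
      filter_upwards [mem_nhdsWithin_of_mem_nhds hnhds] with y hy
      rw [connectedComponentIn_eq hy]
    · intro z hz
      exact (hg _ (h z hz)).2 z ⟨hz, mem_connectedComponentIn (hWF hz)⟩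
  have hL : IsCompact (frontier W ∩ connectedComponentIn F x) := by
    refine hK.of_isClosed_subset ?_ Set.inter_subset_left
    -- The piece is closed because the other components, all open, cover the rest of the boundary.
    have hset : frontier W ∩ connectedComponentIn F x =
        frontier W ∩ (⋃ y ∈ F \ connectedComponentIn F x, connectedComponentIn F y)ᶜ := by
      ext z
      simp only [Set.mem_inter_iff, Set.mem_compl_iff, Set.mem_iUnion, not_exists, exists_prop,
        not_and, Set.mem_sdiff]
      refine and_congr_right fun hz => ⟨fun hzx y hy hzy => hy.2 ?_, fun hz' => ?_⟩
      · rw [connectedComponentIn_eq hzx, ← connectedComponentIn_eq hzy]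
        exact mem_connectedComponentIn hy.1
      · by_contra hzx
        exact hz' z ⟨hWF hz, hzx⟩ (mem_connectedComponentIn (hWF hz))
    rw [hset]
    exact isClosed_frontier.inter (isOpen_biUnion fun y _ => hF.connectedComponentIn).isClosed_compl
  have hbL : b ∉ frontier W ∩ connectedComponentIn F x := fun hb => hbF (hWF hb.1)
  have hop := hL.isClosed.isOpen_compl
  refine ⟨x, hWF hx, connectedComponentIn (frontier W ∩ connectedComponentIn F x)ᶜ b,
    hop.connectedComponentIn, ?_, mem_connectedComponentIn hbL, ?_⟩
  · by_contra hub
    exact hlog (hasLogOn_of_not_isBounded hL hbL hub)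
  · exact fun z hz =>
      (not_not.1 (notMem_of_mem_frontier_connectedComponentIn hop hz)).2

/-! ### The sphere and its chart at infinity -/

namespace RiemannSphere

open Classical in
/-- The point of the sphere with homogeneous coordinates `[a : b]`. -/
noncomputable def frac (a b : ℂ) : RiemannSphere := if b = 0 then ∞ else ((a / b : ℂ) : RiemannSphere)

theorem frac_of_ne {a b : ℂ} (hb : b ≠ 0) : frac a b = ((a / b : ℂ) : RiemannSphere) := if_neg hb

theorem frac_zero (a : ℂ) : frac a 0 = ∞ := if_pos rfl

/-- The inversion `z ↦ 1 / z` of the sphere. -/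
noncomputable def inversion : RiemannSphere → RiemannSphere
  | ∞ => ((0 : ℂ) : RiemannSphere)
  | (z : ℂ) => frac 1 z

@[simp] theorem inversion_infty : inversion ∞ = ((0 : ℂ) : RiemannSphere) := rfl

theorem inversion_coe (z : ℂ) : inversion z = frac 1 z := rfl

@[simp] theorem inversion_zero : inversion ((0 : ℂ) : RiemannSphere) = ∞ := frac_zero 1

theorem inversion_coe_of_ne {z : ℂ} (hz : z ≠ 0) :
    inversion z = ((z⁻¹ : ℂ) : RiemannSphere) := by
  rw [inversion_coe, frac_of_ne hz, one_div]

theorem inversion_frac {a b : ℂ} (h : a ≠ 0 ∨ b ≠ 0) : inversion (frac a b) = frac b a := by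
  by_cases hb : b = 0
  · have ha : a ≠ 0 := h.resolve_right (not_not.2 hb)
    rw [hb, frac_zero, inversion_infty, frac_of_ne ha, zero_div]
  · rw [frac_of_ne hb]
    by_cases ha : a = 0
    · rw [ha, zero_div, inversion_zero, frac_zero]
    · rw [inversion_coe_of_ne (div_ne_zero ha hb), frac_of_ne ha, inv_div]

theorem inversion_involutive : Function.Involutive inversion := by
  intro x
  induction x using OnePoint.rec with
  | infty => simp
  | coe z => rw [inversion_coe, inversion_frac (Or.inl one_ne_zero), frac_of_ne one_ne_zero, div_one]

theorem continuous_inversion : Continuous inversion := by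
  rw [continuous_iff_continuousAt]
  intro x
  induction x using OnePoint.rec with
  | infty =>
    rw [continuousAt_infty', inversion_infty, coclosedCompact_eq_cocompact,
      ← Metric.cobounded_eq_cocompact]
    have h1 := (continuous_coe.tendsto (0 : ℂ)).comp (tendsto_inv₀_cobounded (α := ℂ))
    refine h1.congr' ?_
    filter_upwards [(Bornology.isBounded_def.1 (Bornology.isBounded_singleton (x := (0 : ℂ))))] with z hz
    exact (inversion_coe_of_ne hz).symm
  | coe z =>
    rw [continuousAt_coe]
    by_cases hz : z = 0
    · subst hz
      rw [continuousAt_iff_punctured_nhds]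
      simp only [Function.comp, inversion_zero]
      have h1 := (tendsto_coe_infty (X := ℂ)).comp
        ((coclosedCompact_eq_cocompact (X := ℂ)).symm ▸ Metric.cobounded_eq_cocompact (α := ℂ) ▸
          (tendsto_inv₀_nhdsNE_zero (α := ℂ)))
      refine h1.congr' ?_
      filter_upwards [self_mem_nhdsWithin] with w hw
      exact (inversion_coe_of_ne hw).symm
    · have h1 : ContinuousAt (fun w : ℂ => ((w⁻¹ : ℂ) : RiemannSphere)) z :=
        continuous_coe.continuousAt.comp (continuousAt_inv₀ hz)
      refine h1.congr ?_
      filter_upwards [eventually_ne_nhds hz] with w hw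
      exact (inversion_coe_of_ne hw).symm

/-- The inversion as a homeomorphism. -/
noncomputable def inversionHomeo : RiemannSphere ≃ₜ RiemannSphere where
  toEquiv := inversion_involutive.toPerm
  continuous_toFun := continuous_inversion
  continuous_invFun := continuous_inversion

theorem map_inversion_nhds (x : RiemannSphere) : map inversion (𝓝 x) = 𝓝 (inversion x) :=
  inversionHomeo.map_nhds_eq x

theorem nhds_infty_eq_map :
    𝓝 (∞ : RiemannSphere) = map (fun w : ℂ => inversion w) (𝓝 0) := by
  rw [← inversion_zero, ← map_inversion_nhds, nhds_coe_eq, map_map]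
  rfl

instance : LocallyConnectedSpace RiemannSphere := by
  rw [locallyConnectedSpace_iff_connected_subsets]
  have key : ∀ (e : ℂ → RiemannSphere), Continuous e → ∀ z, 𝓝 (e z) = map e (𝓝 z) →
      ∀ U ∈ 𝓝 (e z), ∃ V ∈ 𝓝 (e z), IsPreconnected V ∧ V ⊆ U := by
    intro e he z hz U hU
    rw [hz, mem_map] at hU
    obtain ⟨r, hr, hrU⟩ := Metric.mem_nhds_iff.1 hU
    refine ⟨e '' Metric.ball z r, ?_, ?_, Set.image_subset_iff.2 hrU⟩
    · rw [hz]
      exact image_mem_map (Metric.ball_mem_nhds z hr)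
    · exact (convex_ball z r).isPreconnected.image _ he.continuousOn
  intro x
  induction x using OnePoint.rec with
  | infty =>
    rw [← inversion_zero]
    refine key (fun w : ℂ => inversion w) (continuous_inversion.comp continuous_coe) 0 ?_
    simpa using nhds_infty_eq_map
  | coe z => exact key _ continuous_coe z (nhds_coe_eq z)

/-- The hypothesis excludes `[0 : 0]`, to which `frac` assigns the default value `∞`. Where the
denominator vanishes, inversion swaps the two coordinates. -/
theorem continuousAt_frac {X : Type*} [TopologicalSpace X] {p q : X → ℂ} {x : X}
    (hp : ContinuousAt p x) (hq : ContinuousAt q x) (h : p x ≠ 0 ∨ q x ≠ 0) :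
    ContinuousAt (fun y => frac (p y) (q y)) x := by
  have main : ∀ {p q : X → ℂ}, ContinuousAt p x → ContinuousAt q x → q x ≠ 0 →
      ContinuousAt (fun y => frac (p y) (q y)) x := by
    intro p q hp hq hqx
    have h1 : ContinuousAt (fun y => ((p y / q y : ℂ) : RiemannSphere)) x :=
      continuous_coe.continuousAt.comp (hp.div hq hqx)
    refine h1.congr ?_
    filter_upwards [hq.eventually_ne hqx] with y hy
    exact (frac_of_ne hy).symm
  by_cases hqx : q x = 0
  · have hpx := h.resolve_right (not_not.2 hqx)
    refine (continuous_inversion.continuousAt.comp (main hq hp hpx)).congr ?_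
    filter_upwards [hp.eventually_ne hpx] with y hy
    exact inversion_frac (Or.inr hy)
  · exact main hp hq hqx

/-- This is the open mapping theorem for analytic quotients, transported by inversion at zeros of
the denominator. -/
theorem nhds_frac_le_map {p q : ℂ → ℂ} {z : ℂ} (hp : AnalyticAt ℂ p z) (hq : AnalyticAt ℂ q z)
    (h : p z ≠ 0 ∨ q z ≠ 0)
    (hne : ∀ c, ¬ ∀ᶠ w in 𝓝 z, frac (p w) (q w) = c) :
    𝓝 (frac (p z) (q z)) ≤ map (fun w => frac (p w) (q w)) (𝓝 z) := by
  have main : ∀ {p q : ℂ → ℂ}, AnalyticAt ℂ p z → AnalyticAt ℂ q z → q z ≠ 0 →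
      (∀ c, ¬ ∀ᶠ w in 𝓝 z, frac (p w) (q w) = c) →
      𝓝 (frac (p z) (q z)) ≤ map (fun w => frac (p w) (q w)) (𝓝 z) := by
    intro p q hp hq hqz hne
    have heq : (fun w => frac (p w) (q w)) =ᶠ[𝓝 z] fun w => ((p w / q w : ℂ) : RiemannSphere) := by
      filter_upwards [hq.continuousAt.eventually_ne hqz] with w hw
      exact frac_of_ne hw
    rw [map_congr heq, frac_of_ne hqz, nhds_coe_eq]
    have han : AnalyticAt ℂ (fun w => p w / q w) z := hp.div hq hqz
    rcases han.eventually_constant_or_nhds_le_map_nhds with hc | hc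
    · refine absurd ?_ (hne ((p z / q z : ℂ) : RiemannSphere))
      filter_upwards [heq, hc] with w h1 h2
      rw [h1, h2]
    · have := map_mono (m := ((↑) : ℂ → RiemannSphere)) hc
      rwa [map_map] at this
  by_cases hqz : q z = 0
  · have hpz := h.resolve_right (not_not.2 hqz)
    have heq : (fun w => frac (p w) (q w)) =ᶠ[𝓝 z] fun w => inversion (frac (q w) (p w)) := by
      filter_upwards [hp.continuousAt.eventually_ne hpz] with w hw
      exact (inversion_frac (Or.inr hw)).symm
    have h1 := main hq hp hpz fun c hc => hne (inversion c) (by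
      filter_upwards [heq, hc] with w h1 h2
      rw [h1, h2])
    have h2 := map_mono (m := inversion) h1
    rw [map_inversion_nhds, inversion_frac (Or.inr hpz), map_map] at h2
    rwa [map_congr heq]
  · exact main hp hq hqz hne

/-- The finite value of a point of the sphere, with value `0` at `∞`. -/
noncomputable def toComplex (x : RiemannSphere) : ℂ := x.elim 0 id

@[simp] theorem toComplex_coe (z : ℂ) : toComplex z = z := rfl

theorem coe_toComplex {x : RiemannSphere} (hx : x ≠ ∞) : (toComplex x : RiemannSphere) = x := by
  lift x to ℂ using hx
  rfl

theorem continuousAt_toComplex {x : RiemannSphere} (hx : x ≠ ∞) : ContinuousAt toComplex x := by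
  lift x to ℂ using hx
  rw [continuousAt_coe]
  exact continuousAt_id

end RiemannSphere

open RiemannSphere

/-! ### Rational maps: continuity, finite fibres, openness -/

section RationalMap

variable (R : RatFunc ℂ)

theorem rationalMap_coe (z : ℂ) :
    rationalMap R z = frac (R.num.eval z) (R.denom.eval z) := rfl

theorem num_eval_ne_zero_or (z : ℂ) : R.num.eval z ≠ 0 ∨ R.denom.eval z ≠ 0 := by
  by_contra! h
  obtain ⟨a, b, hab⟩ := R.isCoprime_num_denom
  have := congrArg (Polynomial.eval z) hab
  simp [h.1, h.2] at this

/-- The common degree in which numerator and denominator are reversed at `∞`. -/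
noncomputable def ratDegree : ℕ := max R.num.natDegree R.denom.natDegree

theorem natDegree_num_le : R.num.natDegree ≤ ratDegree R := le_max_left _ _

theorem natDegree_denom_le : R.denom.natDegree ≤ ratDegree R := le_max_right _ _

theorem coeff_ratDegree_ne_zero_or :
    R.num.coeff (ratDegree R) ≠ 0 ∨ R.denom.coeff (ratDegree R) ≠ 0 := by
  unfold ratDegree
  rcases lt_or_ge R.denom.natDegree R.num.natDegree with h | h
  · left
    rw [max_eq_left h.le, Polynomial.coeff_natDegree, Polynomial.leadingCoeff_ne_zero]
    rintro h0
    simp [h0] at h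
  · right
    rw [max_eq_right h, Polynomial.coeff_natDegree, Polynomial.leadingCoeff_ne_zero]
    exact R.denom_ne_zero

theorem eval_reflect_zero (N : ℕ) (p : Polynomial ℂ) : (p.reflect N).eval 0 = p.coeff N := by
  rw [← Polynomial.coeff_zero_eq_eval_zero, Polynomial.coeff_reflect, Polynomial.revAt_le (zero_le),
    Nat.sub_zero]

theorem eval_reflect_of_ne {N : ℕ} {p : Polynomial ℂ} (hp : p.natDegree ≤ N) {w : ℂ} (hw : w ≠ 0) :
    (p.reflect N).eval w = w ^ N * p.eval w⁻¹ := by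
  have hi : IsUnit w⁻¹ := (inv_ne_zero hw).isUnit
  let _ := invertibleOfNonzero (inv_ne_zero hw)
  have := Polynomial.eval₂_reflect_mul_pow (RingHom.id ℂ) w⁻¹ N p hp
  simp only [Polynomial.eval₂_id, invOf_eq_inv, inv_inv] at this
  rw [← this, inv_pow]
  field_simp

theorem eval_reflect_ne_zero_or (w : ℂ) :
    (R.num.reflect (ratDegree R)).eval w ≠ 0 ∨ (R.denom.reflect (ratDegree R)).eval w ≠ 0 := by
  by_cases hw : w = 0
  · subst hw
    simpa only [eval_reflect_zero] using coeff_ratDegree_ne_zero_or R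
  · rw [eval_reflect_of_ne (natDegree_num_le R) hw, eval_reflect_of_ne (natDegree_denom_le R) hw]
    simpa [hw] using num_eval_ne_zero_or R w⁻¹

/-- Reversing numerator and denominator in the same degree `N` multiplies both values at `1 / w` by
`w ^ N`, which cancels; this expresses the map near `∞` by polynomials. -/
theorem rationalMap_inversion (w : ℂ) : rationalMap R (inversion w) =
    frac ((R.num.reflect (ratDegree R)).eval w) ((R.denom.reflect (ratDegree R)).eval w) := by
  by_cases hw : w = 0
  · subst hw
    rw [inversion_zero, eval_reflect_zero, eval_reflect_zero]
    simp only [rationalMap, ratDegree]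
    split_ifs with h
    · rw [max_eq_left h.le, Polynomial.coeff_eq_zero_of_natDegree_lt h, frac_zero]
    · rw [max_eq_right (not_lt.1 h), frac_of_ne]
      · rfl
      · exact Polynomial.leadingCoeff_ne_zero.2 R.denom_ne_zero
  · rw [inversion_coe_of_ne hw, rationalMap_coe, eval_reflect_of_ne (natDegree_num_le R) hw,
      eval_reflect_of_ne (natDegree_denom_le R) hw]
    have := pow_ne_zero (ratDegree R) hw
    by_cases h0 : R.denom.eval w⁻¹ = 0
    · rw [h0, mul_zero, frac_zero, frac_zero]
    · rw [frac_of_ne h0, frac_of_ne (mul_ne_zero this h0), mul_div_mul_left _ _ this]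

theorem continuous_rationalMap : Continuous (rationalMap R) := by
  rw [continuous_iff_continuousAt]
  intro x
  induction x using OnePoint.rec with
  | infty =>
    rw [ContinuousAt, nhds_infty_eq_map, tendsto_map'_iff]
    have := continuousAt_frac (Polynomial.continuous (R.num.reflect (ratDegree R))).continuousAt
      (Polynomial.continuous (R.denom.reflect (ratDegree R))).continuousAt
      (eval_reflect_ne_zero_or R 0)
    simp only [← rationalMap_inversion] at this
    simpa only [ContinuousAt, inversion_zero, Function.comp_def] using this
  | coe z =>
    rw [continuousAt_coe]
    exact continuousAt_frac (Polynomial.continuous _).continuousAt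
      (Polynomial.continuous _).continuousAt (num_eval_ne_zero_or R z)

variable {R}

theorem finite_fiber (hR : ∀ c, R ≠ RatFunc.C c) (y : RiemannSphere) :
    (rationalMap R ⁻¹' {y}).Finite := by
  have key : ((↑) ⁻¹' (rationalMap R ⁻¹' {y}) : Set ℂ).Finite := by
    induction y using OnePoint.rec with
    | infty =>
      refine (Polynomial.finite_setOfPred_isRoot R.denom_ne_zero).subset fun z hz => ?_
      by_contra h
      have hz' : rationalMap R z = ∞ := hz
      rw [rationalMap_coe, frac_of_ne h] at hz'
      exact coe_ne_infty _ hz'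
    | coe c =>
      have hne : R.num - Polynomial.C c * R.denom ≠ 0 := by
        intro h
        refine hR c ?_
        rw [← RatFunc.num_div_denom R, sub_eq_zero.1 h, map_mul, mul_div_assoc, div_self,
          mul_one, RatFunc.algebraMap_C]
        exact RatFunc.algebraMap_ne_zero R.denom_ne_zero
      refine (Polynomial.finite_setOfPred_isRoot hne).subset fun z hz => ?_
      have hz' : rationalMap R z = c := hz
      rw [rationalMap_coe] at hz'
      by_cases h0 : R.denom.eval z = 0
      · rw [h0, frac_zero] at hz'
        exact absurd hz' (infty_ne_coe c)
      · rw [frac_of_ne h0, coe_eq_coe, div_eq_iff h0] at hz'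
        simp [Polynomial.IsRoot, hz']
  refine ((key.image ((↑) : ℂ → RiemannSphere)).union (Set.finite_singleton ∞)).subset fun x hx => ?_
  induction x using OnePoint.rec with
  | infty => exact Or.inr rfl
  | coe z => exact Or.inl ⟨z, hx, rfl⟩

/-- Finite fibres rule out local constancy, so the open mapping theorem applies in both charts. -/
theorem isOpenMap_rationalMap (hR : ∀ c, R ≠ RatFunc.C c) : IsOpenMap (rationalMap R) := by
  have key : ∀ e : ℂ → RiemannSphere, Function.Injective e → ∀ (z : ℂ) (c : RiemannSphere),
      ¬ ∀ᶠ w in 𝓝 z, rationalMap R (e w) = c := fun e he z c hc =>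
    infinite_of_mem_nhds z hc ((finite_fiber hR c).preimage he.injOn)
  rw [isOpenMap_iff_nhds_le]
  intro x
  induction x using OnePoint.rec with
  | infty =>
    rw [nhds_infty_eq_map, map_map]
    have := nhds_frac_le_map (z := 0) ((R.num.reflect (ratDegree R)).differentiable.analyticAt _)
      ((R.denom.reflect (ratDegree R)).differentiable.analyticAt _)
      (eval_reflect_ne_zero_or R 0) (by
        simp only [← rationalMap_inversion]
        exact key _ (inversion_involutive.injective.comp coe_injective) 0)
    simp only [← rationalMap_inversion, inversion_zero] at this
    exact this
  | coe z =>
    rw [nhds_coe_eq, map_map]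
    exact nhds_frac_le_map (R.num.differentiable.analyticAt _) (R.denom.differentiable.analyticAt _)
      (num_eval_ne_zero_or R z) (key _ coe_injective z)

theorem isOpenMap_iterate {X : Type*} [TopologicalSpace X] {f : X → X} (hf : IsOpenMap f) (n : ℕ) :
    IsOpenMap f^[n] := by
  induction n with
  | zero => exact IsOpenMap.id
  | succ n ih => exact ih.comp hf

theorem differentiableAt_toComplex_iterate (n : ℕ) {z : ℂ}
    (hz : ∀ k ≤ n, (rationalMap R)^[k] z ≠ ∞) :
    DifferentiableAt ℂ (fun w : ℂ => toComplex ((rationalMap R)^[n] w)) z := by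
  induction n with
  | zero => exact differentiableAt_id
  | succ n ih =>
    have hF := ih fun k hk => hz k (hk.trans n.le_succ)
    have hn := hz n n.le_succ
    have hval : ∀ w : ℂ, (rationalMap R)^[n] w ≠ ∞ → (rationalMap R)^[n + 1] w =
        frac (R.num.eval (toComplex ((rationalMap R)^[n] w)))
          (R.denom.eval (toComplex ((rationalMap R)^[n] w))) := fun w hw => by
      rw [Function.iterate_succ_apply', ← rationalMap_coe, coe_toComplex hw]
    have hd : R.denom.eval (toComplex ((rationalMap R)^[n] z)) ≠ 0 := fun h0 =>
      hz (n + 1) le_rfl (by rw [hval z hn, h0, frac_zero])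
    have hcont : ContinuousAt (fun w : ℂ => (rationalMap R)^[n] w) z :=
      (((continuous_rationalMap R).iterate n).comp continuous_coe).continuousAt
    have hdiff : DifferentiableAt ℂ (fun w : ℂ => R.num.eval (toComplex ((rationalMap R)^[n] w)) /
        R.denom.eval (toComplex ((rationalMap R)^[n] w))) z :=
      (R.num.differentiable.differentiableAt.comp z hF).div
        (R.denom.differentiable.differentiableAt.comp z hF) hd
    refine hdiff.congr_of_eventuallyEq ?_
    have hd' : ∀ᶠ w in 𝓝 z, R.denom.eval (toComplex ((rationalMap R)^[n] (w : ℂ))) ≠ 0 :=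
      (R.denom.continuous.continuousAt.comp' hF.continuousAt).eventually_ne hd
    filter_upwards [hd', hcont.eventually_ne hn] with w hw1 hw2
    rw [hval w hw2, frac_of_ne hw1, toComplex_coe]

end RationalMap

/-! ### Continuous convergence and normality -/

/-- The maps `F k` converge continuously to `y` at `x`: `F k x' → y` as `k → ∞` and `x' → x`. -/
def ConvAt {X Y : Type*} [TopologicalSpace X] [TopologicalSpace Y] (F : ℕ → X → Y) (x : X)
    (y : Y) : Prop :=
  Tendsto (fun q : ℕ × X => F q.1 q.2) (atTop ×ˢ 𝓝 x) (𝓝 y)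

section ConvAt

variable {X Y : Type*} [TopologicalSpace X] [TopologicalSpace Y] {F : ℕ → X → Y} {x : X} {y : Y}

theorem ConvAt.comp_tendsto (h : ConvAt F x y) {φ : ℕ → ℕ} (hφ : Tendsto φ atTop atTop) :
    ConvAt (fun k => F (φ k)) x y :=
  Tendsto.comp h ((hφ.comp tendsto_fst).prodMk tendsto_snd)

theorem ConvAt.tendsto (h : ConvAt F x y) : Tendsto (fun k => F k x) atTop (𝓝 y) :=
  Tendsto.comp h (tendsto_id.prodMk tendsto_const_nhds)

theorem convAt_const {f : X → Y} (hf : ContinuousAt f x) : ConvAt (fun _ => f) x (f x) :=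
  Tendsto.comp hf tendsto_snd

theorem ConvAt.continuousOn [RegularSpace Y] {g : X → Y} {D : Set X}
    (h : ∀ x ∈ D, ConvAt F x (g x)) : ContinuousOn g D := by
  intro x hx
  rw [ContinuousWithinAt, (closed_nhds_basis (g x)).tendsto_right_iff]
  rintro C ⟨hC, hCc⟩
  have h1 : ∀ᶠ q : ℕ × X in atTop ×ˢ 𝓝 x, F q.1 q.2 ∈ C := h x hx hC
  have h2 := (eventually_swap_iff.1 h1).curry
  filter_upwards [mem_nhdsWithin_of_mem_nhds h2, self_mem_nhdsWithin] with z hz hzD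
  exact hCc.mem_of_tendsto (h z hzD).tendsto hz

/-- An open continuous map sends the neighbourhood filter of `x` onto that of `f x`; this pushes
normality forward along the rational map. -/
theorem ConvAt.of_comp {f : X → X} (hf : ContinuousAt f x) (ho : IsOpenMap f)
    (h : ConvAt (fun k => F k ∘ f) x y) : ConvAt F (f x) y := by
  rw [ConvAt, ← ho.map_nhds_eq hf, prod_map_right, tendsto_map'_iff]
  exact h

theorem tendstoLocallyUniformlyOn_of_convAt {Y : Type*} [UniformSpace Y] {F : ℕ → X → Y}
    {g : X → Y} {D : Set X} (hD : IsOpen D) (h : ∀ x ∈ D, ConvAt F x (g x)) :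
    TendstoLocallyUniformlyOn F g atTop D := by
  rw [hD.tendstoLocallyUniformlyOn_iff_forall_tendsto]
  intro x hx
  have hg := (ConvAt.continuousOn h).continuousAt (hD.mem_nhds hx)
  have h1 := (Tendsto.comp hg (tendsto_snd (f := (atTop : Filter ℕ)))).prodMk_nhds (h x hx)
  exact h1.mono_right (nhds_le_uniformity _)

theorem TendstoLocallyUniformlyOn.convAt {Y : Type*} [UniformSpace Y] {F : ℕ → X → Y}
    {g : X → Y} {D : Set X} (hD : IsOpen D) (hF : ∀ k, ContinuousOn (F k) D)
    (h : TendstoLocallyUniformlyOn F g atTop D) {x : X} (hx : x ∈ D) : ConvAt F x (g x) := by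
  have hg := (h.continuousOn (Eventually.of_forall hF).frequently).continuousAt (hD.mem_nhds hx)
  rw [hD.tendstoLocallyUniformlyOn_iff_forall_tendsto] at h
  exact (Uniform.tendsto_congr (h x hx)).1 (Tendsto.comp hg tendsto_snd)

end ConvAt

namespace RiemannSphere

/-- On open sets, for continuous maps, locally uniform convergence amounts to continuous convergence
at each point, which makes normality a pointwise condition on one subsequence. -/
theorem isNormalOn_range_iff {F : ℕ → RiemannSphere → RiemannSphere} (hF : ∀ k, Continuous (F k))
    {D : Set RiemannSphere} (hD : IsOpen D) : IsNormalOn (Set.range F) D ↔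
      ∀ n : ℕ → ℕ, ∃ φ : ℕ → ℕ, StrictMono φ ∧ ∀ x ∈ D, ∃ y, ConvAt (fun k => F (n (φ k))) x y := by
  constructor
  · intro h n
    obtain ⟨g, φ, hφ, hg⟩ := h (fun k => F (n k)) fun k => ⟨n k, rfl⟩
    exact ⟨φ, hφ, fun x hx => ⟨g x, hg.convAt hD (fun k => (hF _).continuousOn) hx⟩⟩
  · intro h f hf
    choose n hn using hf
    obtain ⟨φ, hφ, hc⟩ := h n
    choose! g hg using hc
    refine ⟨g, φ, hφ, ?_⟩
    obtain rfl : (fun k => F (n k)) = f := funext hn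
    exact tendstoLocallyUniformlyOn_of_convAt hD hg

/-- To check normality, it suffices to consider sequences of indices tending to infinity. -/
theorem isNormalOn_range_of_tendsto {F : ℕ → RiemannSphere → RiemannSphere}
    (hF : ∀ k, Continuous (F k)) {D : Set RiemannSphere} (hD : IsOpen D)
    (h : ∀ n : ℕ → ℕ, Tendsto n atTop atTop → ∃ φ : ℕ → ℕ, StrictMono φ ∧
      ∀ x ∈ D, ∃ y, ConvAt (fun k => F (n (φ k))) x y) : IsNormalOn (Set.range F) D := by
  rw [isNormalOn_range_iff hF hD]
  intro n
  by_cases hn : ∃ m, ∃ᶠ k in atTop, n k = m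
  · obtain ⟨m, hm⟩ := hn
    obtain ⟨φ, hφ, hc⟩ := extraction_of_frequently_atTop hm
    refine ⟨φ, hφ, fun x _ => ⟨F m x, ?_⟩⟩
    simp only [hc]
    exact convAt_const (hF m).continuousAt
  · refine h n (tendsto_atTop.2 fun m => ?_)
    simp only [not_exists, not_frequently] at hn
    filter_upwards [(eventually_all_finset (Finset.range m)).2 fun i _ => hn i] with k hk
    by_contra hlt
    exact hk (n k) (Finset.mem_range.2 (not_le.1 hlt)) rfl

/-- The points of the sphere of modulus larger than `r`. -/
def outside (r : ℝ) : Set RiemannSphere := {x | ∀ z : ℂ, x = z → r < ‖z‖}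

theorem hasBasis_nhds_infty_outside :
    (𝓝 (∞ : RiemannSphere)).HasBasis (fun _ => True) outside := by
  refine OnePoint.hasBasis_nhds_infty.to_hasBasis ?_ ?_
  · rintro s ⟨-, hs⟩
    obtain ⟨r, hr⟩ := hs.isBounded.exists_norm_le
    refine ⟨r, trivial, fun x hx => ?_⟩
    induction x using OnePoint.rec with
    | infty => exact Or.inr rfl
    | coe z => exact Or.inl ⟨z, fun hz => (hx z rfl).not_ge (hr z hz), rfl⟩
  · rintro r -
    refine ⟨Metric.closedBall 0 r, ⟨Metric.isClosed_closedBall, isCompact_closedBall _ _⟩, ?_⟩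
    rintro x (⟨z, hz, rfl⟩ | rfl)
    · rintro w hw
      obtain rfl := coe_injective hw
      simpa using hz
    · exact fun w hw => absurd hw (infty_ne_coe w)

theorem isOpen_outside (r : ℝ) : IsOpen (outside r) := by
  rw [isOpen_iff_mem_nhds]
  intro x hx
  induction x using OnePoint.rec with
  | infty => exact hasBasis_nhds_infty_outside.mem_of_mem trivial
  | coe z =>
    rw [nhds_coe_eq, mem_map]
    filter_upwards [continuous_norm.continuousAt.eventually_const_lt (hx z rfl)] with w hw v hv
    rwa [← coe_injective hv]

end RiemannSphere

open RiemannSphere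

/-! ### Fatou set and unbounded components -/

section Fatou

variable {R : RatFunc ℂ}

theorem isOpen_fatouSet : IsOpen (fatouSet R) := by
  rw [isOpen_iff_mem_nhds]
  rintro z ⟨U, hU, hz, hn⟩
  filter_upwards [hU.mem_nhds hz] with w hw using ⟨U, hU, hw, hn⟩

theorem continuous_iterate_rationalMap (k : ℕ) : Continuous (rationalMap R)^[k] :=
  (continuous_rationalMap R).iterate k

theorem rationalMap_mem_fatouSet (hR : ∀ c, R ≠ RatFunc.C c) {z : RiemannSphere}
    (hz : z ∈ fatouSet R) : rationalMap R z ∈ fatouSet R := by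
  obtain ⟨U, hU, hz, hn⟩ := hz
  have ho := isOpenMap_rationalMap hR
  refine ⟨rationalMap R '' U, ho _ hU, Set.mem_image_of_mem _ hz, ?_⟩
  rw [isNormalOn_range_iff continuous_iterate_rationalMap hU] at hn
  rw [isNormalOn_range_iff continuous_iterate_rationalMap (ho _ hU)]
  intro n
  obtain ⟨φ, hφ, hc⟩ := hn fun k => n k + 1
  refine ⟨φ, hφ, ?_⟩
  rintro _ ⟨u, hu, rfl⟩
  obtain ⟨y, hy⟩ := hc u hu
  exact ⟨y, ConvAt.of_comp (continuous_rationalMap R).continuousAt ho hy⟩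

theorem iterate_mem_fatouSet (hR : ∀ c, R ≠ RatFunc.C c) (n : ℕ) {z : RiemannSphere}
    (hz : z ∈ fatouSet R) : (rationalMap R)^[n] z ∈ fatouSet R := by
  induction n with
  | zero => exact hz
  | succ n ih =>
    rw [Function.iterate_succ_apply']
    exact rationalMap_mem_fatouSet hR ih

theorem IsFatouComponent.eq_connectedComponentIn {U : Set RiemannSphere} (hU : IsFatouComponent R U)
    {z : RiemannSphere} (hz : z ∈ U) : U = connectedComponentIn (fatouSet R) z := by
  obtain ⟨w, -, rfl⟩ := hU
  exact connectedComponentIn_eq hz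

theorem IsFatouComponent.isPreconnected {U : Set RiemannSphere} (hU : IsFatouComponent R U) :
    IsPreconnected U := by
  obtain ⟨w, -, rfl⟩ := hU
  exact isPreconnected_connectedComponentIn

theorem IsFatouComponent.subset {U : Set RiemannSphere} (hU : IsFatouComponent R U) :
    U ⊆ fatouSet R := by
  obtain ⟨w, -, rfl⟩ := hU
  exact connectedComponentIn_subset _ _

theorem IsFatouComponent.nonempty {U : Set RiemannSphere} (hU : IsFatouComponent R U) :
    U.Nonempty := by
  obtain ⟨w, hw, rfl⟩ := hU
  exact ⟨w, mem_connectedComponentIn hw⟩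

/-- A preconnected subset of the Fatou set meeting a Fatou component lies in it. -/
theorem IsFatouComponent.subset_of_inter_nonempty {U S : Set RiemannSphere}
    (hU : IsFatouComponent R U) (hS : IsPreconnected S) (hSF : S ⊆ fatouSet R)
    (h : (U ∩ S).Nonempty) : S ⊆ U := by
  obtain ⟨z, hzU, hzS⟩ := h
  rw [hU.eq_connectedComponentIn hzU]
  exact hS.subset_connectedComponentIn hzS hSF

theorem IsFatouComponent.eq_of_inter_nonempty {U V : Set RiemannSphere}
    (hU : IsFatouComponent R U) (hV : IsFatouComponent R V) (h : (U ∩ V).Nonempty) : U = V :=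
  (hV.subset_of_inter_nonempty hU.isPreconnected hU.subset (Set.inter_comm U V ▸ h)).antisymm
    (hU.subset_of_inter_nonempty hV.isPreconnected hV.subset h)

theorem RiemannSphere.IsUnbounded.inter_nonempty {U V : Set RiemannSphere} (hU : IsUnbounded U)
    (hV : V ∈ 𝓝 ∞) : (U ∩ V).Nonempty := by
  obtain ⟨r, -, hr⟩ := hasBasis_nhds_infty_outside.mem_iff.1 hV
  by_contra hne
  refine hU ((Metric.isBounded_closedBall (x := (0 : ℂ)) (r := r)).subset fun z hz => ?_)
  by_contra hzr
  refine hne ⟨z, hz, hr fun w hw => ?_⟩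
  rw [← coe_injective hw]
  simpa using hzr

theorem infty_notMem_fatouSet {U V : Set RiemannSphere} (hU : IsFatouComponent R U)
    (hV : IsFatouComponent R V) (hUV : U ≠ V) (hUb : IsUnbounded U) (hVb : IsUnbounded V) :
    ∞ ∉ fatouSet R := by
  intro hi
  have hC : IsFatouComponent R (connectedComponentIn (fatouSet R) ∞) := ⟨∞, hi, rfl⟩
  have hnhds : connectedComponentIn (fatouSet R) ∞ ∈ 𝓝 ∞ :=
    isOpen_fatouSet.connectedComponentIn.mem_nhds (mem_connectedComponentIn hi)
  exact hUV ((hU.eq_of_inter_nonempty hC (hUb.inter_nonempty hnhds)).trans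
    (hV.eq_of_inter_nonempty hC (hVb.inter_nonempty hnhds)).symm)

/-- A set between the connected plane and its closure, the sphere, is connected, which would leave a
single component. -/
theorem not_range_coe_subset_fatouSet {U V : Set RiemannSphere} (hU : IsFatouComponent R U)
    (hV : IsFatouComponent R V) (hUV : U ≠ V) :
    ¬ Set.range ((↑) : ℂ → RiemannSphere) ⊆ fatouSet R := by
  intro h
  have hF : IsPreconnected (fatouSet R) :=
    (isPreconnected_range continuous_coe).subset_closure h
      (by rw [denseRange_coe.closure_range]; exact Set.subset_univ _)
  have key : ∀ W, IsFatouComponent R W → fatouSet R ⊆ W := fun W hW =>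
    hW.subset_of_inter_nonempty hF subset_rfl
      (by rw [Set.inter_eq_left.2 hW.subset]; exact hW.nonempty)
  exact hUV ((hU.subset.trans (key V hV)).antisymm (hV.subset.trans (key U hU)))

end Fatou

/-! ### Existence of a finite pole -/

section NoPoles

variable {R : RatFunc ℂ}

theorem denom_eq_one_of_no_poles (h : ∀ p, ¬ IsPole R p) : R.denom = 1 := by
  by_contra hne
  have hdeg : R.denom.natDegree ≠ 0 := fun h0 =>
    hne ((Polynomial.Monic.natDegree_eq_zero R.monic_denom).1 h0)
  obtain ⟨p, hp⟩ := IsAlgClosed.exists_root R.denom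
    (fun h0 => hdeg (Polynomial.natDegree_eq_zero_iff_degree_le_zero.2 h0.le))
  refine h p ?_
  rw [IsPole, rationalMap_coe, hp, frac_zero]

theorem rationalMap_coe_of_denom_eq_one (h : R.denom = 1) (z : ℂ) :
    rationalMap R z = ((R.num.eval z : ℂ) : RiemannSphere) := by
  rw [rationalMap_coe, h, Polynomial.eval_one, frac_of_ne one_ne_zero, div_one]

/-- A polynomial expanding near `∞` by a factor greater than `1` has `∞` in its Fatou set. -/
theorem infty_mem_fatouSet_of_expanding {c r : ℝ} (hc : 1 < c) (hr : 0 < r)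
    (h : ∀ s, r ≤ s → Set.MapsTo (rationalMap R) (outside s) (outside (c * s))) :
    ∞ ∈ fatouSet R := by
  have hit : ∀ n, Set.MapsTo (rationalMap R)^[n] (outside r) (outside (c ^ n * r)) := by
    intro n
    induction n with
    | zero => simpa using Set.mapsTo_id _
    | succ n ih =>
      rw [Function.iterate_succ', pow_succ', mul_assoc]
      exact (h _ (le_mul_of_one_le_left hr.le (one_le_pow₀ hc.le))).comp ih
  refine ⟨outside r, isOpen_outside r, fun z hz => absurd hz (infty_ne_coe z), ?_⟩
  refine isNormalOn_range_of_tendsto continuous_iterate_rationalMap (isOpen_outside r) ?_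
  intro n hn
  refine ⟨id, strictMono_id, fun x hx => ⟨∞, ?_⟩⟩
  rw [ConvAt, hasBasis_nhds_infty_outside.tendsto_right_iff]
  intro M _
  have h1 : Tendsto (fun k => c ^ n k * r) atTop atTop :=
    ((tendsto_pow_atTop_atTop_of_one_lt hc).comp hn).atTop_mul_const hr
  filter_upwards [(h1.eventually_ge_atTop M).prod_mk ((isOpen_outside r).mem_nhds hx)]
    with q hq z hz
  exact hq.1.trans_lt (hit _ hq.2 z hz)

theorem mapsTo_outside_of_le (hd : R.denom = 1) (hdeg : 0 < R.num.natDegree) {c r : ℝ} (hc : 0 < c)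
    (h : ∀ z : ℂ, r < ‖z‖ → c * ‖z‖ ≤ ‖R.num.eval z‖) (s : ℝ) (hs : r ≤ s) :
    Set.MapsTo (rationalMap R) (outside s) (outside (c * s)) := by
  intro x hx w hw
  induction x using OnePoint.rec with
  | infty =>
    have hinf : rationalMap R ∞ = ∞ := if_pos (by rwa [hd, Polynomial.natDegree_one])
    rw [hinf] at hw
    exact absurd hw (infty_ne_coe w)
  | coe z =>
    rw [rationalMap_coe_of_denom_eq_one hd] at hw
    rw [← coe_injective hw]
    have hz := hx z rfl
    exact (mul_lt_mul_of_pos_left hz hc).trans_le (h z (hs.trans_lt hz))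

/-- The Fatou set of a non-expanding affine map contains the plane. -/
theorem range_coe_subset_fatouSet_of_affine {a b : ℂ} (ha : ‖a‖ ≤ 1)
    (h : ∀ z : ℂ, rationalMap R z = ((a * z + b : ℂ) : RiemannSphere)) :
    Set.range ((↑) : ℂ → RiemannSphere) ⊆ fatouSet R := by
  have hit : ∀ n, ∃ β : ℂ, ∀ z : ℂ, (rationalMap R)^[n] z = ((a ^ n * z + β : ℂ) : RiemannSphere) := by
    intro n
    induction n with
    | zero => exact ⟨0, fun z => by simp⟩
    | succ n ih =>
      obtain ⟨β, hβ⟩ := ih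
      refine ⟨a * β + b, fun z => ?_⟩
      rw [Function.iterate_succ_apply', hβ, h]
      congr 1
      ring
  choose β hβ using hit
  refine fun x hx => ⟨_, isOpen_range_coe, hx, ?_⟩
  rw [isNormalOn_range_iff continuous_iterate_rationalMap isOpen_range_coe]
  intro n
  have hpow : ∀ m, ‖a ^ m‖ ≤ 1 := fun m => by
    rw [norm_pow]; exact pow_le_one₀ (norm_nonneg a) ha
  -- If the translation parts return to a bounded set infinitely often, a subsequence converges to
  -- an affine map; otherwise they tend to `∞` and dominate the bounded term `a ^ n * z`.
  by_cases hb : ∃ r : ℝ, ∃ᶠ k in atTop, β (n k) ∈ Metric.closedBall 0 r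
  · obtain ⟨r, hr⟩ := hb
    obtain ⟨β₀, -, φ, hφ, hφβ⟩ := tendsto_subseq_of_frequently_bounded Metric.isBounded_closedBall hr
    obtain ⟨α₀, -, ψ, hψ, hψα⟩ := tendsto_subseq_of_bounded
      (Metric.isBounded_closedBall (x := (0 : ℂ)) (r := 1)) (x := fun k => a ^ n (φ k))
      fun k => by simpa using hpow (n (φ k))
    refine ⟨φ ∘ ψ, hφ.comp hψ, ?_⟩
    rintro _ ⟨z, rfl⟩
    refine ⟨((α₀ * z + β₀ : ℂ) : RiemannSphere), ?_⟩
    rw [ConvAt, nhds_coe_eq, prod_map_right, tendsto_map'_iff]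
    have h1 : Tendsto (fun q : ℕ × ℂ => a ^ n (φ (ψ q.1)) * q.2 + β (n (φ (ψ q.1))))
        (atTop ×ˢ 𝓝 z) (𝓝 (α₀ * z + β₀)) :=
      ((hψα.comp tendsto_fst).mul tendsto_snd).add
        ((hφβ.comp hψ.tendsto_atTop).comp tendsto_fst)
    refine (Tendsto.comp continuous_coe.continuousAt h1).congr fun q => ?_
    simp [hβ]
  · refine ⟨id, strictMono_id, ?_⟩
    rintro _ ⟨z, rfl⟩
    refine ⟨∞, ?_⟩
    rw [ConvAt, nhds_coe_eq, prod_map_right, tendsto_map'_iff,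
      hasBasis_nhds_infty_outside.tendsto_right_iff]
    intro M _
    simp only [not_exists, not_frequently] at hb
    filter_upwards [(hb (M + ‖z‖ + 1)).prod_mk (Metric.ball_mem_nhds z one_pos)] with q hq w hw
    simp only [Function.comp, Prod.map, id, hβ] at hw
    rw [← coe_injective hw]
    have h1 : M + ‖z‖ + 1 < ‖β (n q.1)‖ := by simpa using hq.1
    have h2 : ‖q.2‖ ≤ ‖z‖ + 1 := by
      have := mem_ball_iff_norm.1 hq.2
      linarith [norm_le_norm_add_norm_sub' q.2 z]
    have h3 : ‖a ^ n q.1 * q.2‖ ≤ ‖q.2‖ := by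
      rw [norm_mul]; exact mul_le_of_le_one_left (norm_nonneg _) (hpow _)
    have h4 := norm_sub_le_norm_add (β (n q.1)) (a ^ n q.1 * q.2)
    rw [add_comm] at h4
    linarith

theorem exists_pole {U V : Set RiemannSphere} (hU : IsFatouComponent R U)
    (hV : IsFatouComponent R V) (hUV : U ≠ V) (hUb : IsUnbounded U) (hVb : IsUnbounded V) :
    ∃ p, IsPole R p := by
  by_contra! hno
  have hd := denom_eq_one_of_no_poles hno
  set P := R.num with hP
  have heval : ∀ z : ℂ, P.eval z = P.divX.eval z * z + P.coeff 0 := fun z => by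
    conv_lhs => rw [← P.divX_mul_X_add]
    simp
  -- Writing `P = z q + P(0)`, either `q` is a constant of modulus at most `1` (`P` is non-expanding
  -- affine or constant), or `|q|` is eventually at least some `c > 1`.
  by_cases hcase : P.divX.natDegree = 0 ∧ ‖P.divX.coeff 0‖ ≤ 1
  · have hq : ∀ z : ℂ, P.divX.eval z = P.divX.coeff 0 := fun z => by
      conv_lhs => rw [Polynomial.eq_C_of_natDegree_eq_zero hcase.1]
      simp
    refine not_range_coe_subset_fatouSet hU hV hUV
      (range_coe_subset_fatouSet_of_affine (b := P.coeff 0) hcase.2 fun z => ?_)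
    rw [rationalMap_coe_of_denom_eq_one hd, ← hP, heval, hq]
  · refine infty_notMem_fatouSet hU hV hUV hUb hVb ?_
    obtain ⟨c, hc, hev⟩ : ∃ c : ℝ, 1 < c ∧
        ∀ᶠ z in Bornology.cobounded ℂ, c ≤ ‖P.divX.eval z‖ := by
      by_cases h0 : P.divX.natDegree = 0
      · refine ⟨‖P.divX.coeff 0‖, not_le.1 fun h => hcase ⟨h0, h⟩, Eventually.of_forall fun z => ?_⟩
        conv_rhs => rw [Polynomial.eq_C_of_natDegree_eq_zero h0]
        simp
      · exact ⟨2, one_lt_two, (P.divX.tendsto_norm_atTop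
          (Polynomial.natDegree_pos_iff_degree_pos.1 (Nat.pos_of_ne_zero h0))
          tendsto_norm_cobounded_atTop).eventually_ge_atTop 2⟩
    have hdeg : 0 < P.natDegree := by
      by_contra h0
      refine hcase ⟨by rw [Polynomial.natDegree_divX_eq_natDegree_tsub_one]; omega, ?_⟩
      rw [Polynomial.coeff_divX, Polynomial.coeff_eq_zero_of_natDegree_lt (by omega), norm_zero]
      exact zero_le_one
    -- Here `|P(0)| ≤ ((c - 1) / 2) |z|`, so subtracting it from `c |z|` still leaves the expansion
    -- factor `(1 + c) / 2 > 1`.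
    have hev2 := (tendsto_norm_cobounded_atTop (E := ℂ)).eventually_ge_atTop
      (‖P.coeff 0‖ / ((c - 1) / 2))
    obtain ⟨r, -, hr⟩ := (Metric.hasBasis_cobounded_compl_closedBall (0 : ℂ)).mem_iff.1
      (hev.and hev2)
    have hc2 : 0 < (c - 1) / 2 := by linarith
    refine infty_mem_fatouSet_of_expanding (c := (1 + c) / 2) (r := max r 1) (by linarith)
      (by positivity) (mapsTo_outside_of_le hd hdeg (by linarith) fun z hz => ?_)
    obtain ⟨h1, h2⟩ := hr (show z ∈ (Metric.closedBall (0 : ℂ) r)ᶜ by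
      simpa using (le_max_left r 1).trans_lt hz)
    rw [div_le_iff₀ hc2] at h2
    rw [← hP, heval]
    have h3 := norm_sub_le_norm_add (P.divX.eval z * z) (P.coeff 0)
    rw [norm_mul] at h3
    nlinarith [mul_le_mul_of_nonneg_right h1 (norm_nonneg z)]

end NoPoles

/-! ### Iterates avoid infinity on `G` -/

section Escape

variable {R : RatFunc ℂ}

/-- Let `f = R^[n]` omit `∞` on a bounded plane open set `G` whose boundary lies in a connected
subset `S` of the Fatou set. An unbounded Fatou component with a boundary point in `f(G)`
contains `f(S)`. -/
theorem image_subset_of_mem_frontier (hR : ∀ c, R ≠ RatFunc.C c) (hinf : ∞ ∉ fatouSet R)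
    {G : Set ℂ} (hGo : IsOpen G) (hGb : Bornology.IsBounded G) {S : Set RiemannSphere}
    (hS : IsPreconnected S) (hSF : S ⊆ fatouSet R) (hGS : ∀ z ∈ frontier G, (z : RiemannSphere) ∈ S)
    {n : ℕ} (hn : ∀ z ∈ G, (rationalMap R)^[n] z ≠ ∞) {U : Set RiemannSphere}
    (hU : IsFatouComponent R U) (hUb : IsUnbounded U) {p : RiemannSphere} (hp : p ∈ closure U)
    (hpG : ∃ z ∈ G, (rationalMap R)^[n] z = p) : (rationalMap R)^[n] '' S ⊆ U := by
  have hcont := continuous_iterate_rationalMap (R := R) n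
  set e : ℂ → RiemannSphere := fun z => (rationalMap R)^[n] z with he
  have hecont : Continuous e := hcont.comp continuous_coe
  have hO : IsOpen (e '' G) :=
    ((isOpenMap_iterate (isOpenMap_rationalMap hR) n).comp isOpenMap_coe) _ hGo
  have hcl : closure (e '' G) ⊆ e '' closure G :=
    closure_minimal (Set.image_mono subset_closure)
      (hGb.isCompact_closure.image hecont).isClosed
  have hclS : ∀ x ∈ closure (e '' G), x ∈ e '' G ∨ x ∈ (rationalMap R)^[n] '' S := by
    intro x hx
    obtain ⟨z, hz, rfl⟩ := hcl hx
    rw [closure_eq_self_union_frontier] at hz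
    exact hz.imp (Set.mem_image_of_mem _) fun h => ⟨z, hGS z h, rfl⟩
  have hfSF : (rationalMap R)^[n] '' S ⊆ fatouSet R := by
    rintro _ ⟨x, hx, rfl⟩
    exact iterate_mem_fatouSet hR n (hSF hx)
  have hinfcl : ∞ ∉ closure (e '' G) := fun h => by
    rcases hclS _ h with ⟨z, hz, hz'⟩ | h
    · exact hn z hz hz'
    · exact hinf (hfSF h)
  refine hU.subset_of_inter_nonempty (hS.image _ hcont.continuousOn) hfSF ?_
  by_contra hne
  obtain ⟨z, hz, rfl⟩ := hpG
  -- If `U` missed `f(S)`, the disjoint open sets `f(G)` and the complement of its closure would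
  -- cover the connected `U`, and both meet it: one near `p`, the other near `∞`.
  obtain ⟨x, -, hx1, hx2⟩ := hU.isPreconnected (e '' G) (closure (e '' G))ᶜ hO
    isClosed_closure.isOpen_compl
    (fun x hx => by
      by_cases h : x ∈ closure (e '' G)
      · exact Or.inl ((hclS x h).resolve_right fun h' => hne ⟨x, hx, h'⟩)
      · exact Or.inr h)
    (Set.inter_comm U _ ▸ mem_closure_iff.1 hp _ hO ⟨z, hz, rfl⟩)
    (hUb.inter_nonempty (isClosed_closure.isOpen_compl.mem_nhds hinfcl))
  exact hx2 (subset_closure hx1)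

theorem iterate_ne_infty (hR : ∀ c, R ≠ RatFunc.C c) (hinf : ∞ ∉ fatouSet R)
    (hpole : ∀ p, IsPole R p → ∃ U V, IsFatouComponent R U ∧ IsFatouComponent R V ∧ U ≠ V ∧
      IsUnbounded U ∧ IsUnbounded V ∧ (p : RiemannSphere) ∈ closure U ∩ closure V)
    {G : Set ℂ} (hGo : IsOpen G) (hGb : Bornology.IsBounded G) {S : Set RiemannSphere}
    (hS : IsPreconnected S) (hSn : S.Nonempty) (hSF : S ⊆ fatouSet R)
    (hGS : ∀ z ∈ frontier G, (z : RiemannSphere) ∈ S) (n : ℕ) :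
    ∀ z ∈ G, (rationalMap R)^[n] z ≠ ∞ := by
  induction n with
  | zero => exact fun z _ => coe_ne_infty z
  | succ n ih =>
    intro z hz hzn
    rw [Function.iterate_succ_apply', ← coe_toComplex (ih z hz)] at hzn
    obtain ⟨U, V, hU, hV, hUV, hUb, hVb, hpU, hpV⟩ := hpole _ hzn
    have hzp : ∃ w ∈ G, (rationalMap R)^[n] w = toComplex ((rationalMap R)^[n] z) :=
      ⟨z, hz, (coe_toComplex (ih z hz)).symm⟩
    have h1 := image_subset_of_mem_frontier hR hinf hGo hGb hS hSF hGS ih hU hUb hpU hzp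
    have h2 := image_subset_of_mem_frontier hR hinf hGo hGb hS hSF hGS ih hV hVb hpV hzp
    obtain ⟨x, hx⟩ := hSn.image (rationalMap R)^[n]
    exact hUV (hU.eq_of_inter_nonempty hV ⟨x, h1 hx, h2 hx⟩)

end Escape

/-! ### Hurwitz, the maximum principle and normality on `G` -/

theorem IsCompact.eventually_forall_of_prod_nhds {ι X : Type*} [TopologicalSpace X] {K : Set X}
    (hK : IsCompact K) {l : Filter ι} {p : ι → X → Prop}
    (h : ∀ x ∈ K, ∀ᶠ q in l ×ˢ 𝓝 x, p q.1 q.2) : ∀ᶠ i in l, ∀ x ∈ K, p i x := by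
  have h1 : {q : ι × X | p q.1 q.2} ∈ l ×ˢ 𝓝ˢ K := hK.mem_prod_nhdsSet_of_forall h
  have h2 : ∀ᶠ q in l ×ˢ 𝓝ˢ K, p q.1 q.2 := h1
  filter_upwards [h2.curry] with i hi x hx
  exact mem_of_mem_nhds (mem_nhdsSet_iff_forall.1 hi x hx)

/-- **Hurwitz's theorem**: a limit of nonvanishing holomorphic functions that vanishes at a point
vanishes near that point. -/
theorem eventually_eq_zero_of_convAt {h : ℕ → ℂ → ℂ} {H : ℂ → ℂ} {D : Set ℂ} (hD : IsOpen D)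
    (hd : ∀ k, DifferentiableOn ℂ (h k) D) (h0 : ∀ k, ∀ z ∈ D, h k z ≠ 0)
    (hH : ∀ z ∈ D, ConvAt h z (H z)) {w : ℂ} (hw : w ∈ D) (hHw : H w = 0) :
    ∀ᶠ z in 𝓝 w, H z = 0 := by
  have hHd : DifferentiableOn ℂ H D :=
    (tendstoLocallyUniformlyOn_of_convAt hD hH).differentiableOn (Eventually.of_forall hd) hD
  rcases (hHd.analyticAt (hD.mem_nhds hw)).eventually_eq_zero_or_eventually_ne_zero with hz | hz
  · exact hz
  exfalso
  rw [eventually_nhdsWithin_iff] at hz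
  obtain ⟨r, hr, hball⟩ := Metric.nhds_basis_closedBall.mem_iff.1 (hz.and (hD.mem_nhds hw))
  have hsD : Metric.sphere w r ⊆ D := fun z hz => (hball (Metric.sphere_subset_closedBall hz)).2
  have hne : (Metric.sphere w r).Nonempty := NormedSpace.sphere_nonempty.2 hr.le
  obtain ⟨z₀, hz₀, hmin⟩ := (isCompact_sphere w r).exists_isMinOn hne (hHd.continuousOn.mono hsD).norm
  have hm : 0 < ‖H z₀‖ := norm_pos_iff.2
    ((hball (Metric.sphere_subset_closedBall hz₀)).1 (Metric.ne_of_mem_sphere hz₀ hr.ne'))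
  have hev : ∀ᶠ k in atTop, ∀ z ∈ Metric.sphere w r, ‖H z₀‖ / 2 < ‖h k z‖ := by
    refine (isCompact_sphere w r).eventually_forall_of_prod_nhds fun z hz => ?_
    have h1 : ‖H z₀‖ / 2 < ‖H z‖ := (half_lt_self hm).trans_le (hmin hz)
    exact (Tendsto.norm (hH z (hsD hz))).eventually_const_lt h1
  have hlim : ∀ᶠ k in atTop, ‖h k w‖ < ‖H z₀‖ / 2 := by
    refine (hH w hw).tendsto.norm.eventually_lt_const ?_
    rw [hHw, norm_zero]
    exact half_pos hm
  obtain ⟨k, hk1, hk2⟩ := (hev.and hlim).exists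
  -- The maximum principle for `1 / h k` forbids a value at the centre smaller than the lower bound
  -- on the circle.
  have hmax := Complex.norm_le_of_forall_mem_frontier_norm_le (f := fun z => (h k z)⁻¹)
    (U := Metric.ball w r) Metric.isBounded_ball
    (by
      refine DifferentiableOn.diffContOnCl ?_
      rw [closure_ball w hr.ne']
      exact ((hd k).mono fun z hz => (hball hz).2).inv fun z hz => h0 k z (hball hz).2)
    (C := (‖H z₀‖ / 2)⁻¹) (fun z hz => by
      rw [frontier_ball w hr.ne'] at hz
      rw [norm_inv]
      exact inv_anti₀ (half_pos hm) (hk1 z hz).le)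
    (subset_closure (Metric.mem_ball_self hr))
  rw [norm_inv, inv_le_inv₀ (norm_pos_iff.2 (h0 k w hw)) (half_pos hm)] at hmax
  exact hmax.not_gt hk2

namespace RiemannSphere

/-- The Möbius map `x ↦ 1 / (x - p)` with finite values, with value `0` at the pole `p`. -/
noncomputable def invSub (p : ℂ) (x : RiemannSphere) : ℂ := x.elim 0 fun z => (z - p)⁻¹

@[simp] theorem invSub_infty (p : ℂ) : invSub p ∞ = 0 := rfl

@[simp] theorem invSub_coe (p z : ℂ) : invSub p z = (z - p)⁻¹ := rfl

theorem invSub_eq_zero_iff {p : ℂ} {x : RiemannSphere} (hx : x ≠ p) : invSub p x = 0 ↔ x = ∞ := by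
  induction x using OnePoint.rec with
  | infty => simp
  | coe z =>
    have : z - p ≠ 0 := sub_ne_zero.2 fun h => hx (h ▸ rfl)
    simp [this]

theorem invSub_of_ne_infty {p : ℂ} {x : RiemannSphere} (hx : x ≠ ∞) :
    invSub p x = (toComplex x - p)⁻¹ := by
  lift x to ℂ using hx
  rfl

theorem continuousAt_invSub {p : ℂ} {x : RiemannSphere} (hx : x ≠ p) :
    ContinuousAt (invSub p) x := by
  induction x using OnePoint.rec with
  | infty =>
    rw [continuousAt_infty', invSub_infty, coclosedCompact_eq_cocompact,
      ← Metric.cobounded_eq_cocompact]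
    exact tendsto_inv₀_cobounded.comp (tendsto_sub_const_cobounded p)
  | coe z =>
    rw [continuousAt_coe]
    have : z - p ≠ 0 := sub_ne_zero.2 fun h => hx (h ▸ rfl)
    exact ContinuousAt.inv₀ (by fun_prop) this

end RiemannSphere

section Dichotomy

variable {R : RatFunc ℂ}

theorem ConvAt.comp_continuousAt {X Y Z : Type*} [TopologicalSpace X] [TopologicalSpace Y]
    [TopologicalSpace Z] {F : ℕ → X → Y} {x : X} {y : Y} (h : ConvAt F x y) {m : Y → Z}
    (hm : ContinuousAt m y) : ConvAt (fun k z => m (F k z)) x (m y) :=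
  Tendsto.comp hm h

theorem convAt_coe_iff {F : ℕ → RiemannSphere → RiemannSphere} {z : ℂ} {y : RiemannSphere} :
    ConvAt F z y ↔ ConvAt (fun k (w : ℂ) => F k w) z y := by
  rw [ConvAt, nhds_coe_eq, prod_map_right, tendsto_map'_iff]
  rfl

/-- On a domain omitting `∞` and a pole along all iterates, the limit of a convergent sequence of
iterates is either everywhere or nowhere infinite. -/
theorem limit_eq_infty_of_preconnected {p : ℂ} (hp : IsPole R p) {D : Set ℂ} (hD : IsOpen D)
    (hDc : IsPreconnected D) (hT : ∀ n, ∀ z ∈ D, (rationalMap R)^[n] z ≠ ∞) {n : ℕ → ℕ}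
    {g : ℂ → RiemannSphere}
    (hg : ∀ z ∈ D, ConvAt (fun k (w : ℂ) => (rationalMap R)^[n k] w) z (g z))
    {z w : ℂ} (hz : z ∈ D) (hw : w ∈ D) (hgz : g z = ∞) : g w = ∞ := by
  have hgc := ConvAt.continuousOn hg
  refine hDc.of_eventually_iff (P := fun z => g z = ∞) (fun x hx => ?_) hz hw hgz
  have hgx := hgc.continuousAt (hD.mem_nhds hx)
  by_cases hx0 : g x = ∞
  · have hev := (hD.eventually_mem hx).and (hgx.eventually_ne (show g x ≠ p by
      rw [hx0]; exact infty_ne_coe p))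
    obtain ⟨E, hE, hEo, hxE⟩ := eventually_nhds_iff.1 hev
    -- An iterate equal to the pole `p` would give `∞` one step later, so `p` is omitted too.
    have hnep : ∀ k, ∀ z ∈ D, toComplex ((rationalMap R)^[n k] (z : ℂ)) - p ≠ 0 := by
      intro k z hz h0
      refine hT (n k + 1) z hz ?_
      rw [Function.iterate_succ_apply', ← coe_toComplex (hT (n k) z hz), sub_eq_zero.1 h0]
      exact hp
    have hform : ∀ k, ∀ z ∈ D, invSub p ((rationalMap R)^[n k] (z : ℂ)) =
        (toComplex ((rationalMap R)^[n k] (z : ℂ)) - p)⁻¹ := fun k z hz =>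
      invSub_of_ne_infty (hT (n k) z hz)
    have hH := eventually_eq_zero_of_convAt (h := fun k z => invSub p ((rationalMap R)^[n k] (z : ℂ)))
      (H := fun z => invSub p (g z)) hEo (fun k => by
        refine DifferentiableOn.congr (fun z hz => ?_) fun z hz => hform k z (hE z hz).1
        exact (((differentiableAt_toComplex_iterate (n k) fun i _ => hT i z (hE z hz).1).sub_const
          p).inv (hnep k z (hE z hz).1)).differentiableWithinAt)
      (fun k z hz => by
        rw [hform k z (hE z hz).1]
        exact inv_ne_zero (hnep k z (hE z hz).1))
      (fun z hz => (hg z (hE z hz).1).comp_continuousAt (continuousAt_invSub (hE z hz).2))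
      hxE (by rw [hx0, invSub_infty])
    filter_upwards [hH, hEo.mem_nhds hxE] with y hy hyE
    exact ⟨fun _ => (invSub_eq_zero_iff (hE y hyE).2).1 hy, fun _ => hx0⟩
  · filter_upwards [hgx.eventually_ne hx0] with y hy
    exact ⟨fun h => absurd h hx0, fun h => absurd h hy⟩

/-- On a plane domain in the Fatou set, a sequence of iterates tends to `∞` at all points or at
none. -/
theorem tendsto_infty_of_preconnected {p : ℂ} (hp : IsPole R p) {D : Set ℂ} (hD : IsOpen D)
    (hDc : IsPreconnected D) (hDF : ∀ z ∈ D, (z : RiemannSphere) ∈ fatouSet R)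
    (hT : ∀ n, ∀ z ∈ D, (rationalMap R)^[n] z ≠ ∞) {n : ℕ → ℕ} {z w : ℂ} (hz : z ∈ D) (hw : w ∈ D)
    (h : Tendsto (fun k => (rationalMap R)^[n k] z) atTop (𝓝 ∞)) :
    Tendsto (fun k => (rationalMap R)^[n k] w) atTop (𝓝 ∞) := by
  refine hDc.of_eventually_iff
    (P := fun z : ℂ => Tendsto (fun k => (rationalMap R)^[n k] z) atTop (𝓝 ∞)) (fun x hx => ?_) hz hw h
  obtain ⟨U, hU, hxU, hN⟩ := hDF x hx
  rw [isNormalOn_range_iff continuous_iterate_rationalMap hU] at hN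
  obtain ⟨r, hr, hball⟩ := Metric.mem_nhds_iff.1
    (inter_mem (hD.mem_nhds hx) ((hU.preimage continuous_coe).mem_nhds hxU))
  have key : ∀ a ∈ Metric.ball x r, ∀ b ∈ Metric.ball x r,
      Tendsto (fun k => (rationalMap R)^[n k] (a : ℂ)) atTop (𝓝 ∞) →
      Tendsto (fun k => (rationalMap R)^[n k] (b : ℂ)) atTop (𝓝 ∞) := by
    intro a ha b hb hta
    -- The original sequence need not converge at `b`; normality gives every subsequence a
    -- convergent further one, to which the dichotomy applies.
    refine tendsto_of_subseq_tendsto fun ns hns => ?_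
    obtain ⟨φ, hφ, hc⟩ := hN fun k => n (ns k)
    choose! g hg using hc
    have hg' : ∀ z ∈ Metric.ball x r,
        ConvAt (fun k (w : ℂ) => (rationalMap R)^[n (ns (φ k))] w) z (g z) := fun z hz =>
      convAt_coe_iff.1 (hg z (hball hz).2)
    have hga : g a = ∞ := tendsto_nhds_unique (hg' a ha).tendsto
      (hta.comp (hns.comp hφ.tendsto_atTop))
    have hgb := limit_eq_infty_of_preconnected hp Metric.isOpen_ball
      (convex_ball x r).isPreconnected (fun m z hz => hT m z (hball hz).1) hg' ha hb hga
    exact ⟨φ, hgb ▸ (hg' b hb).tendsto⟩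
  filter_upwards [Metric.ball_mem_nhds x hr] with y hy
  exact ⟨key x (Metric.mem_ball_self hr) y hy, key y hy x (Metric.mem_ball_self hr)⟩

/-- Finitely many normality neighbourhoods cover `K`, so successive extraction suffices. -/
theorem exists_subseq_convAt_of_isCompact {K : Set ℂ} (hK : IsCompact K)
    (hKF : ∀ z ∈ K, (z : RiemannSphere) ∈ fatouSet R) (n : ℕ → ℕ) :
    ∃ φ : ℕ → ℕ, StrictMono φ ∧
      ∀ z ∈ K, ∃ y, ConvAt (fun k (w : ℂ) => (rationalMap R)^[n (φ k)] w) z y := by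
  revert n
  refine hK.induction_on (p := fun s => ∀ n : ℕ → ℕ, ∃ φ : ℕ → ℕ, StrictMono φ ∧
      ∀ z ∈ s, ∃ y, ConvAt (fun k (w : ℂ) => (rationalMap R)^[n (φ k)] w) z y) ?_ ?_ ?_ ?_
  · exact fun n => ⟨id, strictMono_id, by simp⟩
  · intro s t hst h n
    obtain ⟨φ, hφ, hc⟩ := h n
    exact ⟨φ, hφ, fun z hz => hc z (hst hz)⟩
  · intro s t hs ht n
    obtain ⟨φ, hφ, hc⟩ := hs n
    obtain ⟨ψ, hψ, hc'⟩ := ht fun k => n (φ k)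
    refine ⟨φ ∘ ψ, hφ.comp hψ, ?_⟩
    rintro z (hz | hz)
    · obtain ⟨y, hy⟩ := hc z hz
      exact ⟨y, hy.comp_tendsto hψ.tendsto_atTop⟩
    · exact hc' z hz
  · intro x hx
    obtain ⟨U, hU, hxU, hN⟩ := hKF x hx
    rw [isNormalOn_range_iff continuous_iterate_rationalMap hU] at hN
    refine ⟨_, mem_nhdsWithin_of_mem_nhds ((hU.preimage continuous_coe).mem_nhds hxU), fun n => ?_⟩
    obtain ⟨φ, hφ, hc⟩ := hN n
    refine ⟨φ, hφ, fun z hz => ?_⟩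
    obtain ⟨y, hy⟩ := hc z hz
    exact ⟨y, convAt_coe_iff.1 hy⟩

/-- The iterates are normal on a bounded plane open set `G` whose boundary lies in a plane domain `D`
in the Fatou set, if no iterate takes the value `∞` on `G` or on `D`. -/
theorem isNormalOn_of_frontier_subset {p : ℂ} (hp : IsPole R p) {D : Set ℂ} (hD : IsOpen D)
    (hDc : IsPreconnected D) (hDF : ∀ z ∈ D, (z : RiemannSphere) ∈ fatouSet R)
    (hDT : ∀ n, ∀ z ∈ D, (rationalMap R)^[n] z ≠ ∞) {G : Set ℂ} (hG : IsOpen G)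
    (hGb : Bornology.IsBounded G) (hGT : ∀ n, ∀ z ∈ G, (rationalMap R)^[n] z ≠ ∞)
    (hGD : frontier G ⊆ D) :
    IsNormalOn (Set.range fun n : ℕ => (rationalMap R)^[n]) ((↑) '' G) := by
  have hGo : IsOpen ((↑) '' G : Set RiemannSphere) := isOpen_image_coe.2 hG
  have hK : IsCompact (frontier G) :=
    hGb.isCompact_closure.of_isClosed_subset isClosed_frontier frontier_subset_closure
  have hclT : ∀ n, ∀ z ∈ closure G, (rationalMap R)^[n] z ≠ ∞ := by
    intro n z hz
    rw [closure_eq_self_union_frontier] at hz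
    exact hz.elim (hGT n z) fun h => hDT n z (hGD h)
  have hdiff : ∀ m, DifferentiableOn ℂ (fun w : ℂ => toComplex ((rationalMap R)^[m] w)) (closure G) :=
    fun m z hz => (differentiableAt_toComplex_iterate m fun i _ => hclT i z hz).differentiableWithinAt
  have hnep : ∀ m, ∀ z ∈ closure G, toComplex ((rationalMap R)^[m] (z : ℂ)) - p ≠ 0 := by
    intro m z hz h0
    refine hclT (m + 1) z hz ?_
    rw [Function.iterate_succ_apply', ← coe_toComplex (hclT m z hz), sub_eq_zero.1 h0]
    exact hp
  rw [isNormalOn_range_iff continuous_iterate_rationalMap hGo]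
  intro n
  obtain ⟨φ, hφ, hc⟩ := exists_subseq_convAt_of_isCompact hK (fun z hz => hDF z (hGD hz)) n
  refine ⟨φ, hφ, ?_⟩
  choose! g hg using hc
  by_cases hcase : ∃ z ∈ frontier G, g z = ∞
  · obtain ⟨z₀, hz₀, hgz₀⟩ := hcase
    have hall : ∀ z ∈ frontier G, g z = ∞ := fun z hz =>
      tendsto_nhds_unique (hg z hz).tendsto (tendsto_infty_of_preconnected hp hD hDc hDF hDT
        (n := fun k => n (φ k)) (hGD hz₀) (hGD hz) (hgz₀ ▸ (hg z₀ hz₀).tendsto))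
    rintro _ ⟨z, hz, rfl⟩
    refine ⟨∞, ?_⟩
    rw [convAt_coe_iff, ConvAt, hasBasis_nhds_infty_outside.tendsto_right_iff]
    intro M _
    -- If `|1 / (w - p)|` is at most the inverse of this constant, then `|w| ≥ |w - p| - |p| ≥ |M| +
    -- 1 > M`.
    have hpos : 0 < |M| + ‖p‖ + 1 := by positivity
    have hev : ∀ᶠ k in atTop, ∀ w ∈ frontier G,
        ‖invSub p ((rationalMap R)^[n (φ k)] (w : ℂ))‖ < (|M| + ‖p‖ + 1)⁻¹ := by
      refine hK.eventually_forall_of_prod_nhds fun w hw => ?_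
      have h1 := (hg w hw).comp_continuousAt (m := invSub p)
        (continuousAt_invSub (by rw [hall w hw]; exact infty_ne_coe p))
      rw [hall w hw, invSub_infty] at h1
      refine (Tendsto.norm h1).eventually_lt_const ?_
      rw [norm_zero]
      exact inv_pos.2 hpos
    filter_upwards [hev.prod_mk (hG.mem_nhds hz)] with q hq w hw
    have hle : ‖(toComplex ((rationalMap R)^[n (φ q.1)] (q.2 : ℂ)) - p)⁻¹‖ ≤ (|M| + ‖p‖ + 1)⁻¹ := by
      refine Complex.norm_le_of_forall_mem_frontier_norm_le
        (f := fun z : ℂ => (toComplex ((rationalMap R)^[n (φ q.1)] z) - p)⁻¹) hGb ?_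
        (fun w hw => ?_) (subset_closure hq.2)
      · exact (((hdiff _).sub_const p).inv fun z hz => hnep _ z hz).diffContOnCl
      · have := hq.1 w hw
        rw [invSub_of_ne_infty (hclT _ w (frontier_subset_closure hw))] at this
        exact this.le
    rw [hw, toComplex_coe, norm_inv, inv_le_inv₀ _ hpos] at hle
    · linarith [le_abs_self M, norm_sub_le w p]
    · have := hnep (n (φ q.1)) q.2 (subset_closure hq.2)
      rw [hw] at this
      exact norm_pos_iff.2 this
  · have hfin : ∀ z ∈ frontier G, g z ≠ ∞ := fun z hz h => hcase ⟨z, hz, h⟩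
    set F : ℕ → ℂ → ℂ := fun k z => toComplex ((rationalMap R)^[n (φ k)] (z : ℂ)) with hF
    -- With finite limits on the boundary, differences of iterates are uniformly small there, hence
    -- on all of `closure G`.
    have hcauchy : UniformCauchySeqOn F atTop (closure G) := by
      rw [Metric.uniformCauchySeqOn_iff]
      intro ε hε
      have hev : ∀ᶠ q : ℕ × ℕ in atTop ×ˢ atTop, ∀ w ∈ frontier G, ‖F q.1 w - F q.2 w‖ < ε / 2 := by
        refine hK.eventually_forall_of_prod_nhds fun w hw => ?_
        have h1 := (hg w hw).comp_continuousAt (continuousAt_toComplex (hfin w hw))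
        have h2 : Tendsto (fun q : (ℕ × ℕ) × ℂ => F q.1.1 q.2 - F q.1.2 q.2)
            ((atTop ×ˢ atTop) ×ˢ 𝓝 w) (𝓝 (toComplex (g w) - toComplex (g w))) :=
          (Tendsto.comp h1 ((tendsto_fst.comp tendsto_fst).prodMk tendsto_snd)).sub
            (Tendsto.comp h1 ((tendsto_snd.comp tendsto_fst).prodMk tendsto_snd))
        rw [sub_self] at h2
        refine h2.norm.eventually_lt_const ?_
        rw [norm_zero]
        exact half_pos hε
      rw [prod_atTop_atTop_eq, eventually_atTop] at hev
      obtain ⟨⟨N₁, N₂⟩, hN⟩ := hev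
      refine ⟨max N₁ N₂, fun k hk l hl z hz => ?_⟩
      rw [dist_eq_norm]
      refine (Complex.norm_le_of_forall_mem_frontier_norm_le (f := fun z => F k z - F l z) hGb
        ((hdiff _).sub (hdiff _)).diffContOnCl
        (fun w hw => (hN (k, l) ⟨(le_max_left _ _).trans hk, (le_max_right _ _).trans hl⟩ w hw).le)
        hz).trans_lt (half_lt_self hε)
    have hlim : ∀ z ∈ closure G, ∃ y, Tendsto (fun k => F k z) atTop (𝓝 y) := fun z hz =>
      cauchySeq_tendsto_of_complete (hcauchy.cauchySeq hz)
    choose! H hH using hlim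
    have hunif := (hcauchy.tendstoUniformlyOn_of_tendsto hH).mono subset_closure
    rintro _ ⟨z, hz, rfl⟩
    refine ⟨(H z : RiemannSphere), ?_⟩
    have h1 := (hunif.tendstoLocallyUniformlyOn.convAt hG
      (fun k => (hdiff _).continuousOn.mono subset_closure) hz).comp_continuousAt
      (continuous_coe.continuousAt (x := H z))
    rw [convAt_coe_iff]
    refine Tendsto.congr' ?_ h1
    filter_upwards [(Eventually.of_forall fun _ => trivial : ∀ᶠ k : ℕ in atTop, True).prod_mk
      (hG.mem_nhds hz)] with q hq
    exact coe_toComplex (hGT _ _ hq.2)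

end Dichotomy

/-! ### Connectedness of the Julia set -/

theorem juliaSet_isConnected_of_poles {R : RatFunc ℂ} {U V : Set RiemannSphere}
    (hU : IsFatouComponent R U) (hV : IsFatouComponent R V) (hUV : U ≠ V)
    (hUb : IsUnbounded U) (hVb : IsUnbounded V)
    (hpole : ∀ p, IsPole R p → ∃ U V, IsFatouComponent R U ∧ IsFatouComponent R V ∧ U ≠ V ∧
      IsUnbounded U ∧ IsUnbounded V ∧ (p : RiemannSphere) ∈ closure U ∩ closure V) :
    IsConnected (juliaSet R) := by
  have hinf := infty_notMem_fatouSet hU hV hUV hUb hVb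
  obtain ⟨p, hp⟩ := exists_pole hU hV hUV hUb hVb
  have hR : ∀ c, R ≠ RatFunc.C c := by
    rintro c rfl
    have : rationalMap (RatFunc.C c) p = ∞ := hp
    rw [rationalMap_coe, RatFunc.denom_C, Polynomial.eval_one, frac_of_ne one_ne_zero] at this
    exact coe_ne_infty _ this
  have hJ : IsClosed (juliaSet R) := isOpen_fatouSet.isClosed_compl
  refine ⟨⟨∞, hinf⟩, (isPreconnected_iff_subset_of_fully_disjoint_closed hJ).2 ?_⟩
  have key : ∀ A B : Set RiemannSphere, IsClosed A → IsClosed B → juliaSet R ⊆ A ∪ B →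
      Disjoint A B → ∞ ∈ A → juliaSet R ⊆ A := by
    intro A B hA hB hAB hdisj hiA b hbJ
    by_contra hbA
    have hbB := (hAB hbJ).resolve_left hbA
    obtain ⟨W, hW, hBW, hWA⟩ := normal_exists_closure_subset hB hA.isOpen_compl
      hdisj.subset_compl_left
    have hb : b ≠ ∞ := fun h => hbA (h ▸ hiA)
    lift b to ℂ using hb
    have hclW : closure ((↑) ⁻¹' W : Set ℂ) ⊆ (↑) ⁻¹' closure W :=
      continuous_coe.closure_preimage_subset W
    have hWb : Bornology.IsBounded ((↑) ⁻¹' W : Set ℂ) :=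
      (((isClosed_iff_of_notMem fun h => hWA h hiA).1 isClosed_closure).2.isBounded).subset
        (Set.preimage_mono subset_closure)
    have hF' : IsOpen ((↑) ⁻¹' fatouSet R : Set ℂ) := isOpen_fatouSet.preimage continuous_coe
    obtain ⟨x, hx, G, hG, hGb, hbG, hGx⟩ := exists_isOpen_frontier_subset_component hF'
      -- A Julia point on the boundary of `W` would lie in `A`, which `closure W` misses, or in `B`,
      -- which is interior to `W`.
      (W := (↑) ⁻¹' W) hWb (fun z hz => by
        by_contra hzF
        rcases hAB (show (z : RiemannSphere) ∈ juliaSet R from hzF) with h | h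
        · exact hWA (hclW (frontier_subset_closure hz)) h
        · refine hz.2 ?_
          rw [(hW.preimage continuous_coe).interior_eq]
          exact hBW h) (hBW hbB) hbJ
    set D := connectedComponentIn ((↑) ⁻¹' fatouSet R : Set ℂ) x with hDdef
    have hDc : IsPreconnected D := isPreconnected_connectedComponentIn
    have hDF : ∀ z ∈ D, (z : RiemannSphere) ∈ fatouSet R := connectedComponentIn_subset _ _
    have hGT := iterate_ne_infty hR hinf hpole hG hGb
      (hDc.image _ continuous_coe.continuousOn) ⟨x, x, mem_connectedComponentIn hx, rfl⟩
      (Set.image_subset_iff.2 hDF) (fun z hz => ⟨z, hGx hz, rfl⟩)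
    have hDT : ∀ n, ∀ z ∈ D, (rationalMap R)^[n] z ≠ ∞ := fun n z hz h =>
      hinf (h ▸ iterate_mem_fatouSet hR n (hDF z hz))
    exact hbJ ⟨_, isOpen_image_coe.2 hG, ⟨b, hbG, rfl⟩,
      isNormalOn_of_frontier_subset hp hF'.connectedComponentIn hDc hDF hDT hG hGb hGT hGx⟩
  intro A B hA hB hAB hdisj
  rcases hAB (show ∞ ∈ juliaSet R from hinf) with h | h
  · exact Or.inl (key A B hA hB hAB hdisj h)
  · exact Or.inr (key B A hB hA (Set.union_comm A B ▸ hAB) hdisj.symm h)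

theorem mainTheorem4 (R : RatFunc ℂ) (l : ℕ) (hl : 2 ≤ l) (U : Fin l → Set RiemannSphere)
    (hU_distinct : Function.Injective U)
    (hU_component : ∀ i, IsFatouComponent R (U i))
    (hU_unbounded : ∀ i, RiemannSphere.IsUnbounded (U i))
    (hpole : ∀ p : ℂ, IsPole R p →
      ∃ i j : Fin l, i ≠ j ∧ (p : RiemannSphere) ∈ frontier (U i) ∩ frontier (U j)) :
    IsConnected (juliaSet R) := by
  have h01 : (⟨0, by omega⟩ : Fin l) ≠ ⟨1, by omega⟩ := by simp
  refine juliaSet_isConnected_of_poles (hU_component _) (hU_component _) (hU_distinct.ne h01)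
    (hU_unbounded _) (hU_unbounded _) fun p hp => ?_
  obtain ⟨i, j, hij, hpi, hpj⟩ := hpole p hp
  exact ⟨U i, U j, hU_component i, hU_component j, hU_distinct.ne hij, hU_unbounded i,
    hU_unbounded j, frontier_subset_closure hpi, frontier_subset_closure hpj⟩
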